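/- Let $S$ be a compact oriented surface, each component of which has non-empty boundary, and let $h:S\to S$ be a homeomorphism that is the identity on $\partial S$. Let $M=(S,h)$ be the closed 3-manifold with open book $(S,h)$, that is, the quotient of $S\times[0,1]$ by $(x,1)\sim(h(x),0)$ for $x\in S$ and $(x,t)\sim(x,t')$ for $x\in\partial S$; the images of the surfaces $S\times\{t\}$ are the pages, and $M$ carries the product orientation. Let $C$ be a simple closed curve in the interior of a page $S=S\times\{t_0\}$, $0<t_0<1$, which bounds an embedded disc $D$ in $M$. Let $N\cong S^1\times D^2$ be a regular neighbourhood of $C$ in standard position with respect to $S$ and $D$: it is disjoint from the binding and from the page $S\times\{0\}$, it meets the page $S\times\{t_0\}$ in an annular neighbourhood $A$ of $C$ in $S$, which is the horizontal annulus $S^1\times[-1,1]$ of the solid torus, and it meets $D$ in a collar of $\partial D$ consisting of one radius of each meridian disc. On $\partial N$ let $\mu$ be the meridian of $N$, let $\lambda_D$ be the class of the curve $D\cap\partial N$, and let $\lambda_S$ be the common class of the two curves $S\cap\partial N$, where $\lambda_S$ and $\lambda_D$ are oriented parallel to $C$ and $\mu$ is oriented so that it has linking number $+1$ with $C$ (right-hand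 rule). The twisting $tw_C(S)\in\mathbb Z$ is defined by $\lambda_S=\lambda_D+tw_C(S)\,\mu$. Let $T_C$ be the right-handed Dehn twist about $C$, supported in $A$. Suppose that $tw_C(S)=0$, let $q\in\mathbb Z$, and let $Y$ be the result of Dehn surgery on $C$ with slope $-\mu+q\lambda_D$ (equivalently $\mu-q\lambda_D$): the interior of $N$ is removed, and a solid torus $V$ is glued to the exterior by a linear homeomorphism $\partial V\to\partial N$ which takes the meridian of $V$ to a curve of that slope. Then: 1. $Y$ has an open book decomposition given by $(S,T_C^q h)$: there is a homeomorphism $\Phi$ from $Y$ to the manifold $(S,T_C^q h)$. It can be chosen so that on the exterior $M\setminus \mathrm{int}\,N\subset Y$ it takes points of the page $S\times\{t\}$ to points of the page $S\times\{t\}$, for each $t$, and is the identity $(x,t_0)\mapsto(x,t_0)$ on the part of the page $S\times\{t_0\}$ in the exterior. 2. The analogues of $C$, $D$ and $S$ exist in $Y$ as embedded objects, and in $Y$ it remains the case that $tw_C(S)=0$: in $(S,T_C^qh)$ the curve $C\subset S\times\{t_0\}$ bounds an embedded disc $D'$ and has a regular neighbourhood $N'\subset\Phi(V)$, in standard position with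 respect to $S\times\{t_0\}$ and $D'$ and meeting $S\times\{t_0\}$ in a concentric subannulus of $A$, such that $D'\setminus\Phi(V)=\Phi(D\setminus N)$ and the twisting of $S\times\{t_0\}$ along $C$ defined by $D'$ and $N'$ is $0$. -/

import Mathlib

open scoped Manifold

noncomputable section

namespace Stallings

/-! ### Discs, curves and classes of curves on a torus -/

/-- The closed unit disc in `ℂ`. -/
abbrev Disc : Type := Metric.closedBall (0 : ℂ) 1

/-- The point `r • w` of the disc. -/
def Disc.polar (r : unitInterval) (w : Circle) : Disc :=
  ⟨((r : ℝ) : ℂ) * (w : ℂ), by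
    have h0 := r.2.1
    have h1 := r.2.2
    simpa [abs_of_nonneg h0, Circle.norm_coe] using h1⟩

/-- The boundary point `w` of the disc. -/
def Disc.ofCircle (w : Circle) : Disc := Disc.polar 1 w

/-- The point `s` of the horizontal diameter of the disc. -/
def Disc.ofReal (s : Set.Icc (-1 : ℝ) 1) : Disc :=
  ⟨((s : ℝ) : ℂ), by
    have h := abs_le.2 s.2
    simpa using h⟩

/-- The solid torus `S¹ × D²`. -/
abbrev SolidTorus : Type := Circle × Disc

/-- The self-map `f` of the circle has degree `n`. -/
def HasDegree (f : Circle → Circle) (n : ℤ) : Prop :=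
  ∃ φ : ℝ → ℝ, Continuous φ ∧ (∀ t, f (Circle.exp t) = Circle.exp (φ t)) ∧
    ∀ t, φ (t + 2 * Real.pi) = φ t + 2 * Real.pi * n

/-- `H₁` of the torus `S¹ × ∂D²`. The first entry is the coefficient of `{1} × ∂D²`, the second
that of `S¹ × {1}`. -/
abbrev TorusH1 : Type := ℤ × ℤ

/-- The loop `c` in `S¹ × ∂D²` represents the class `v`. -/
def HasClass (c : Circle → Circle × Circle) (v : TorusH1) : Prop :=
  HasDegree (fun u => (c u).2) v.1 ∧ HasDegree (fun u => (c u).1) v.2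

/-- The linear self-map of the torus `S¹ × ∂D²` with integer matrix `B`. -/
def linearTorusMap (B : Matrix (Fin 2) (Fin 2) ℤ) (p : Circle × Circle) : Circle × Circle :=
  (p.1 ^ B 0 0 * p.2 ^ B 0 1, p.1 ^ B 1 0 * p.2 ^ B 1 1)

/-! ### Oriented surfaces -/

/-- A map between planar domains, injective near `z`, preserves orientation at `z`: the images of
small positively oriented circles about `z` wind `+1` times around `f z`. -/
def PreservesOrientationAt (f : ℂ → ℂ) (z : ℂ) : Prop :=
  ∃ R > 0, ∀ r : ℝ, 0 < r → r < R → ∃ φ : ℝ → ℝ, Continuous φ ∧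
    (∀ t : ℝ, f (z + r * (Circle.exp t : ℂ)) ≠ f z ∧
      f (z + r * (Circle.exp t : ℂ)) - f z =
        (‖f (z + r * (Circle.exp t : ℂ)) - f z‖ : ℂ) * (Circle.exp (φ t) : ℂ)) ∧
    φ (2 * Real.pi) = φ 0 + 2 * Real.pi

/-- An orientation of a topological surface with boundary: an atlas of planar charts covering the
interior, with orientation-preserving transition maps. -/
structure SurfaceOrientation (S : Type*) [TopologicalSpace S]
    [ChartedSpace (EuclideanHalfSpace 2) S] where
  charts : Set (OpenPartialHomeomorph S ℂ)
  covers : ∀ x ∈ (𝓡∂ 2).interior S, ∃ e ∈ charts, x ∈ e.source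
  compatible : ∀ e ∈ charts, ∀ e' ∈ charts, ∀ x ∈ e.source ∩ e'.source,
    PreservesOrientationAt (fun z => e' (e.symm z)) (e x)

/-- An annular neighbourhood, in the interior of the surface `S`, of the simple closed curve
parametrized by `γ`, which is the core of the annulus. -/
structure AnnularNbhd {S : Type*} [TopologicalSpace S]
    [ChartedSpace (EuclideanHalfSpace 2) S] (γ : Circle → S) where
  toFun : Circle × Set.Icc (-1 : ℝ) 1 → S
  continuous_toFun : Continuous toFun
  injective_toFun : Function.Injective toFun
  isOpen_image : IsOpen (toFun '' {p | |(p.2 : ℝ)| < 1})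
  mem_interior : ∀ p, toFun p ∈ (𝓡∂ 2).interior S
  core : ∀ u, toFun (u, ⟨0, by norm_num⟩) = γ u

section Surface

variable {S : Type*} [TopologicalSpace S] [ChartedSpace (EuclideanHalfSpace 2) S]

namespace AnnularNbhd

variable {γ : Circle → S} (A : AnnularNbhd γ)

/-- The parametrization `(θ, s) ↦ A (e^{iθ}, s)` of the annulus is positively oriented with
respect to the orientation `o`, the strip `ℝ × (-1, 1)` being oriented as a subset of `ℂ`. -/
def IsPositive (o : SurfaceOrientation S) : Prop :=
  ∀ e ∈ o.charts, ∀ (θ : ℝ) (s : Set.Icc (-1 : ℝ) 1), |(s : ℝ)| < 1 →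
    A.toFun (Circle.exp θ, s) ∈ e.source →
    PreservesOrientationAt
      (fun z => e (A.toFun (Circle.exp z.re, Set.projIcc (-1 : ℝ) 1 (by norm_num) z.im)))
      ⟨θ, s⟩

/-- `A'` is the concentric annulus `A (u, c s)`, for some `0 < c ≤ 1`. -/
def IsShrinkingOf (A' A : AnnularNbhd γ) : Prop :=
  ∃ c : ℝ, 0 < c ∧ c ≤ 1 ∧ ∀ (u : Circle) (s s' : Set.Icc (-1 : ℝ) 1),
    (s' : ℝ) = c * s → A'.toFun (u, s) = A.toFun (u, s')

/-- The `n`-fold twist `(u, s) ↦ (u e^{n π i (s + 1)}, s)` of the standard annulus. -/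
def modelTwist (n : ℤ) (p : Circle × Set.Icc (-1 : ℝ) 1) : Circle × Set.Icc (-1 : ℝ) 1 :=
  (p.1 * Circle.exp (n * (Real.pi * ((p.2 : ℝ) + 1))), p.2)

open Classical in
/-- The twist supported in the annulus, as a map. -/
def twistFun (n : ℤ) (x : S) : S :=
  if h : ∃ p, A.toFun p = x then A.toFun (modelTwist n h.choose) else x

theorem twistFun_apply (n : ℤ) (p : Circle × Set.Icc (-1 : ℝ) 1) :
    A.twistFun n (A.toFun p) = A.toFun (modelTwist n p) := by
  have h : ∃ p', A.toFun p' = A.toFun p := ⟨p, rfl⟩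
  rw [twistFun, dif_pos h, A.injective_toFun h.choose_spec]

theorem twistFun_of_notMem (n : ℤ) {x : S} (hx : x ∉ Set.range A.toFun) :
    A.twistFun n x = x := by
  rw [twistFun, dif_neg]
  exact hx

theorem modelTwist_boundary (n : ℤ) {p : Circle × Set.Icc (-1 : ℝ) 1}
    (hp : ¬ |(p.2 : ℝ)| < 1) : modelTwist n p = p := by
  obtain ⟨u, s, hs⟩ := p
  have h1 : s = 1 ∨ s = -1 := by
    have h2 : |s| ≤ 1 := abs_le.2 hs
    have h3 : |s| = 1 := le_antisymm h2 (not_lt.1 hp)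
    exact eq_or_eq_neg_of_abs_eq h3
  have h4 : Circle.exp (n * (Real.pi * (s + 1))) = 1 := by
    rcases h1 with rfl | rfl
    · rw [Circle.exp_eq_one]
      exact ⟨n, by ring⟩
    · simp
  simp [modelTwist, h4]

theorem twistFun_eqOn (n : ℤ) {x : S} (hx : x ∉ A.toFun '' {p | |(p.2 : ℝ)| < 1}) :
    A.twistFun n x = x := by
  by_cases h : x ∈ Set.range A.toFun
  · obtain ⟨p, rfl⟩ := h
    rw [twistFun_apply, modelTwist_boundary]
    exact fun hp => hx ⟨p, hp, rfl⟩
  · exact A.twistFun_of_notMem n h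

theorem continuous_modelTwist (n : ℤ) : Continuous (modelTwist n) := by
  unfold modelTwist
  fun_prop

theorem continuous_twistFun [T2Space S] (n : ℤ) : Continuous (A.twistFun n) := by
  have hemb : Topology.IsClosedEmbedding A.toFun :=
    A.continuous_toFun.isClosedEmbedding A.injective_toFun
  have h1 : ContinuousOn (A.twistFun n) (Set.range A.toFun) := by
    rw [← Set.image_univ, hemb.isInducing.continuousOn_image_iff]
    have : A.twistFun n ∘ A.toFun = A.toFun ∘ modelTwist n := by
      funext p
      exact A.twistFun_apply n p
    rw [this]
    exact (A.continuous_toFun.comp (continuous_modelTwist n)).continuousOn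
  have h2 : ContinuousOn (A.twistFun n) (A.toFun '' {p | |(p.2 : ℝ)| < 1})ᶜ :=
    continuousOn_id.congr fun x hx => A.twistFun_eqOn n hx
  have h3 := h1.union_of_isClosed h2 hemb.isClosed_range A.isOpen_image.isClosed_compl
  rw [← continuousOn_univ]
  refine h3.mono fun x _ => ?_
  by_cases hx : x ∈ A.toFun '' {p | |(p.2 : ℝ)| < 1}
  · exact Or.inl (Set.image_subset_range _ _ hx)
  · exact Or.inr hx

theorem modelTwist_neg (n : ℤ) (p : Circle × Set.Icc (-1 : ℝ) 1) :
    modelTwist (-n) (modelTwist n p) = p := by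
  obtain ⟨u, s⟩ := p
  simp only [modelTwist, mul_assoc, ← Circle.exp_add]
  simp

theorem twistFun_neg (n : ℤ) (x : S) : A.twistFun (-n) (A.twistFun n x) = x := by
  by_cases h : x ∈ Set.range A.toFun
  · obtain ⟨p, rfl⟩ := h
    rw [twistFun_apply, twistFun_apply, modelTwist_neg]
  · rw [A.twistFun_of_notMem n h, A.twistFun_of_notMem _ h]

/-- The Dehn twist about the core of the annulus,
`A (e^{iθ}, s) ↦ A (e^{i (θ + π (s + 1))}, s)`, extended by the identity. It is the right-handed
Dehn twist for the orientation of `S` for which `(θ, s)` are positive coordinates: an arc which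
crosses the annulus is turned to the right. -/
def dehnTwist [T2Space S] : S ≃ₜ S where
  toFun := A.twistFun 1
  invFun := A.twistFun (-1)
  left_inv := A.twistFun_neg 1
  right_inv := A.twistFun_neg (-1)
  continuous_toFun := A.continuous_twistFun 1
  continuous_invFun := A.continuous_twistFun (-1)

end AnnularNbhd

/-! ### The 3-manifold of an open book -/

/-- The identifications `(x, 1) ∼ (h x, 0)`, and `(x, t) ∼ (x, t')` for `x ∈ ∂S`. -/
inductive OpenBookRel (h : S ≃ₜ S) : S × unitInterval → S × unitInterval → Prop
  | monodromy (x : S) : OpenBookRel h (x, 1) (h x, 0)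
  | binding (x : S) (hx : x ∈ (𝓡∂ 2).boundary S) (t t' : unitInterval) :
      OpenBookRel h (x, t) (x, t')

/-- The closed 3-manifold with open book `(S, h)`: the quotient of `S × [0, 1]` by the relation
above. Its pages are the images of the surfaces `S × {t}`, and its binding is the image of
`∂S × [0, 1]`. -/
def OpenBook (h : S ≃ₜ S) : Type _ := Quot (OpenBookRel h)

instance (h : S ≃ₜ S) : TopologicalSpace (OpenBook h) :=
  inferInstanceAs (TopologicalSpace (Quot (OpenBookRel h)))

/-- The point of the manifold `OpenBook h` which is represented by a point of `S × [0, 1]`. -/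
def OpenBook.mk (h : S ≃ₜ S) (p : S × unitInterval) : OpenBook h := Quot.mk _ p

/-- A regular neighbourhood `S¹ × D²` of the curve `γ` in the page `S × {t₀}`. It avoids the
binding and the page `S × {0}`, so that it is also a subset of `S × [0, 1]`. It meets
`S × {t₀}` in the annulus `A`, which is the horizontal annulus `S¹ × [-1, 1]` of the solid torus,
and the part of the solid torus over the upper half disc is above the page. If `A` is positively
oriented in `S`, then this parametrization is positively oriented in `S × [0, 1]`. -/
structure RegularNbhd {γ : Circle → S} (A : AnnularNbhd γ) (t₀ : unitInterval) where
  toFun : SolidTorus → S × unitInterval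
  continuous_toFun : Continuous toFun
  injective_toFun : Function.Injective toFun
  isOpen_image : IsOpen (toFun '' {p | ‖(p.2 : ℂ)‖ < 1})
  mem_interior : ∀ p, (toFun p).1 ∈ (𝓡∂ 2).interior S
  level_pos : ∀ p, 0 < (toFun p).2
  level_lt_one : ∀ p, (toFun p).2 < 1
  page : ∀ u s, toFun (u, Disc.ofReal s) = (A.toFun (u, s), t₀)
  above : ∀ p : SolidTorus, 0 < (p.2 : ℂ).im → t₀ < (toFun p).2
  below : ∀ p : SolidTorus, (p.2 : ℂ).im < 0 → (toFun p).2 < t₀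

namespace RegularNbhd

variable {γ : Circle → S} {A : AnnularNbhd γ} {t₀ : unitInterval} (N : RegularNbhd A t₀)

/-- The neighbourhood as a subset of the manifold. -/
def carrier (h : S ≃ₜ S) : Set (OpenBook h) :=
  Set.range fun p => OpenBook.mk h (N.toFun p)

/-- The open solid torus. -/
def openCarrier (h : S ≃ₜ S) : Set (OpenBook h) :=
  (fun p => OpenBook.mk h (N.toFun p)) '' {p | ‖(p.2 : ℂ)‖ < 1}

/-- The exterior of the curve. -/
abbrev Exterior (h : S ≃ₜ S) : Type _ := {x : OpenBook h // x ∉ N.openCarrier h}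

/-- The point of `∂N` with coordinates in `S¹ × ∂D²`. -/
def boundaryPoint (h : S ≃ₜ S) (p : Circle × Circle) : OpenBook h :=
  OpenBook.mk h (N.toFun (p.1, Disc.ofCircle p.2))

end RegularNbhd

/-- The meridian `μ` of a regular neighbourhood: the class of `{1} × ∂D²` with its
counterclockwise orientation. -/
def meridian : TorusH1 := (1, 0)

/-- A component, in the coordinates of `∂N`, of the intersection of the page with `∂N`. -/
def pageCurve (u : Circle) : Circle × Circle := (u, 1)

/-- An embedded disc `D` in the manifold `OpenBook h`, bounded by the curve `γ` in the page
`S × {t₀}` and in standard position with respect to the regular neighbourhood `N`: the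
intersection of `D` and `N` is a collar of `∂D` in `D`, and it consists of one radius, in the
direction `dir u`, of each meridian disc `{u} × D²`. -/
structure SpanningDisc {γ : Circle → S} {A : AnnularNbhd γ} {t₀ : unitInterval}
    (h : S ≃ₜ S) (N : RegularNbhd A t₀) where
  toFun : Disc → OpenBook h
  continuous_toFun : Continuous toFun
  injective_toFun : Function.Injective toFun
  dir : Circle → Circle
  continuous_dir : Continuous dir
  collar : ∀ (z : Disc) (u : Circle) (s : unitInterval),
    (z : ℂ) = ((1 - (s : ℝ) / 2 : ℝ) : ℂ) * (u : ℂ) →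
      toFun z = OpenBook.mk h (N.toFun (u, Disc.polar s (dir u)))
  notMem : ∀ z : Disc, ‖(z : ℂ)‖ < 1 / 2 → toFun z ∉ N.carrier h

namespace SpanningDisc

variable {γ : Circle → S} {A : AnnularNbhd γ} {t₀ : unitInterval} {h : S ≃ₜ S}
  {N : RegularNbhd A t₀} (D : SpanningDisc h N)

/-- The curve in which `D` meets `∂N`, in the coordinates of `∂N`, oriented as `γ`. -/
def longitudeCurve (u : Circle) : Circle × Circle := (u, D.dir u)

/-- The twisting of the page along the curve is `n`: `λ_S = λ_D + n μ`. -/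
def HasTwisting (n : ℤ) : Prop :=
  ∃ lamS lamD : TorusH1, HasClass pageCurve lamS ∧ HasClass D.longitudeCurve lamD ∧
    lamS = lamD + n • meridian

end SpanningDisc

/-! ### Dehn surgery -/

/-- The boundary of the new solid torus is glued to `∂N` by the linear map with matrix `B`. -/
inductive SurgeryRel {γ : Circle → S} {A : AnnularNbhd γ} {t₀ : unitInterval}
    (h : S ≃ₜ S) (N : RegularNbhd A t₀) (B : Matrix (Fin 2) (Fin 2) ℤ) :
    N.Exterior h ⊕ SolidTorus → N.Exterior h ⊕ SolidTorus → Prop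
  | glue (x : N.Exterior h) (u w : Circle) (hx : x.1 = N.boundaryPoint h (linearTorusMap B (u, w))) :
      SurgeryRel h N B (Sum.inl x) (Sum.inr (u, Disc.ofCircle w))

/-- The result of Dehn surgery along the curve: the open solid torus is removed and a solid torus
is glued to the exterior by the linear map with matrix `B`. -/
def Surgery {γ : Circle → S} {A : AnnularNbhd γ} {t₀ : unitInterval}
    (h : S ≃ₜ S) (N : RegularNbhd A t₀) (B : Matrix (Fin 2) (Fin 2) ℤ) : Type _ :=
  Quot (SurgeryRel h N B)

/-- `B` is invertible and the meridian of the new solid torus is glued to a curve of slope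
`± v`: the surgery with gluing matrix `B` is a surgery with slope `v`. -/
def IsGluingOfSlope (B : Matrix (Fin 2) (Fin 2) ℤ) (v : TorusH1) : Prop :=
  IsUnit B.det ∧ (HasClass (fun w => linearTorusMap B (1, w)) v ∨
    HasClass (fun w => linearTorusMap B (1, w)) (-v))

namespace Surgery

variable {γ : Circle → S} {A : AnnularNbhd γ} {t₀ : unitInterval}
  (h : S ≃ₜ S) (N : RegularNbhd A t₀) (B : Matrix (Fin 2) (Fin 2) ℤ)

instance : TopologicalSpace (Surgery h N B) :=
  inferInstanceAs (TopologicalSpace (Quot (SurgeryRel h N B)))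

/-- The exterior of the curve as a part of the surgered manifold. -/
def ofExterior (x : N.Exterior h) : Surgery h N B := Quot.mk _ (Sum.inl x)

/-- The glued-in solid torus as a part of the surgered manifold. -/
def newTorus : Set (Surgery h N B) := Set.range fun p : SolidTorus => Quot.mk _ (Sum.inr p)

end Surgery

end Surface

end Stallings

end

/-!
Write `T` for the `q`-th power of the Dehn twist. Cutting `M` along the page `S × {t₀}` and
applying `T` to everything below it gives a bijection from `(S, h)` to `(S, T h)` which is
discontinuous only at the points of that page that `T` moves; these lie inside `N`. It is therefore
a homeomorphism on the exterior of `N`, preserving the pages, and it carries `N` to another regular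
neighbourhood of the curve.

In the coordinates of the two solid tori the bijection is `(u, z) ↦ (u g(z) ^ q, z)`, where `g` is
`1` above the page and a rotation by an angle depending on `Re z` below it. On the boundary `g` is
continuous of degree one, that is `g(w) = w e ^ {i δ(w)}` for a continuous real function `δ`. Up to
the factor coming from `δ`, which extends over the solid torus by Tietze's theorem, the bijection
is the linear shear `(u, w) ↦ (u w ^ q, w)` of the torus, which takes the slope `-μ + q λ_D` to the
meridian. Composed with the gluing map of the surgery it thus extends over the new solid torus.

Since the twisting is zero, the direction in which the disc enters `N` has degree zero and lifts to
a real function. The image of the disc outside of `N` can therefore be continued in the new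
neighbourhood by a collar along which the direction is isotoped to the horizontal one, `1`.
-/

noncomputable section

namespace Stallings

/-! ### Degrees -/

theorem HasDegree.unique {f : Circle → Circle} {m n : ℤ} (hm : HasDegree f m)
    (hn : HasDegree f n) : m = n := by
  obtain ⟨φ, hφ, hfφ, hpφ⟩ := hm
  obtain ⟨ψ, hψ, hfψ, hpψ⟩ := hn
  have hpi : 2 * Real.pi ≠ 0 := by positivity
  have hdiff : ∀ t, ∃ k : ℤ, φ t = ψ t + k * (2 * Real.pi) := fun t =>
    Circle.exp_eq_exp.1 ((hfφ t).symm.trans (hfψ t))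
  choose k hk using hdiff
  have hk_eq : ∀ t, (k t : ℝ) = (φ t - ψ t) / (2 * Real.pi) := fun t => by
    rw [hk t, add_sub_cancel_left, mul_div_cancel_right₀ _ hpi]
  have hk_continuous : Continuous k :=
    Int.isClosedEmbedding_coe_real.isEmbedding.continuous_iff.2 <|
      (by fun_prop : Continuous fun t => (φ t - ψ t) / (2 * Real.pi)).congr fun t => (hk_eq t).symm
  have hk_const : k (0 + 2 * Real.pi) = k 0 :=
    PreconnectedSpace.constant inferInstance hk_continuous
  have hperiod := hpφ 0
  rw [hk, hk 0, hpψ, hk_const] at hperiod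
  exact_mod_cast mul_left_cancel₀ hpi (by linarith : 2 * Real.pi * (m : ℝ) = 2 * Real.pi * n)

theorem hasDegree_zpow (n : ℤ) : HasDegree (fun u => u ^ n) n :=
  ⟨fun t => n * t, by fun_prop, fun t => (Circle.exp_intCast_mul t n).symm, fun t => by ring⟩

theorem hasDegree_id : HasDegree (fun u => u) 1 := by
  simpa only [zpow_one] using hasDegree_zpow 1

theorem hasDegree_const_one : HasDegree (fun _ => 1) 0 := by
  simpa only [zpow_zero] using hasDegree_zpow 0

theorem HasDegree.exists_lift {f : Circle → Circle} (hf : HasDegree f 0) :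
    ∃ φ : C(Circle, ℝ), ∀ u, f u = Circle.exp (φ u) := by
  obtain ⟨φ, hφ, hfφ, hpφ⟩ := hf
  have hperiodic : Function.Periodic φ (2 * Real.pi) := fun t => by
    simpa only [Int.cast_zero, mul_zero, add_zero] using hpφ t
  have hquot : Topology.IsQuotientMap Circle.exp :=
    isLocalHomeomorph_circleExp.isOpenMap.isQuotientMap Circle.exp.continuous
      fun u => ⟨_, Circle.exp_arg u⟩
  have harg : ∀ t, φ (Circle.exp t : ℂ).arg = φ t := fun t => by
    obtain ⟨k, hk⟩ := Circle.exp_eq_exp.1 (Circle.exp_arg (Circle.exp t))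
    rw [hk]
    exact hperiodic.int_mul k t
  exact ⟨⟨fun u => φ (u : ℂ).arg, hquot.continuous_iff.2 (hφ.congr fun t => (harg t).symm)⟩,
    fun u => (congrArg f (Circle.exp_arg u)).symm.trans (hfφ _)⟩

theorem HasClass.unique {c : Circle → Circle × Circle} {v w : TorusH1} (hv : HasClass c v)
    (hw : HasClass c w) : v = w :=
  Prod.ext (hv.1.unique hw.1) (hv.2.unique hw.2)

theorem hasClass_pageCurve : HasClass pageCurve (0, 1) :=
  ⟨hasDegree_const_one, hasDegree_id⟩

theorem hasClass_linearTorusMap_one (B : Matrix (Fin 2) (Fin 2) ℤ) :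
    HasClass (fun w => linearTorusMap B (1, w)) (B 1 1, B 0 1) := by
  constructor <;> simpa only [linearTorusMap, one_zpow, one_mul] using hasDegree_zpow _

theorem IsGluingOfSlope.exists_units {B : Matrix (Fin 2) (Fin 2) ℤ} {q : ℤ}
    (hB : IsGluingOfSlope B (-1, q)) :
    ∃ d e : ℤˣ, B 1 1 = d ∧ B 0 1 + d * q = 0 ∧ B 0 0 + B 1 0 * q = e := by
  obtain ⟨hdet, hslope⟩ := hB
  obtain ⟨d, hd, hdq⟩ : ∃ d : ℤˣ, B 1 1 = d ∧ B 0 1 + d * q = 0 := by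
    rcases hslope with h | h
    · have hv := Prod.ext_iff.1 ((hasClass_linearTorusMap_one B).unique h)
      exact ⟨-1, hv.1, by simpa [← sub_eq_add_neg, sub_eq_zero] using hv.2⟩
    · have hv := Prod.ext_iff.1 ((hasClass_linearTorusMap_one B).unique h)
      exact ⟨1, hv.1, by simpa [← eq_neg_iff_add_eq_zero] using hv.2⟩
  have hdet_eq : B.det = (B 0 0 + B 1 0 * q) * d := by
    rw [Matrix.det_fin_two, hd, eq_neg_of_add_eq_zero_left hdq]
    ring
  obtain ⟨e, he⟩ := isUnit_of_mul_isUnit_left (hdet_eq ▸ hdet)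
  exact ⟨d, e, hd, hdq, he.symm⟩

/-! ### Quotients and images -/

theorem apply_mem_iff_of_fixed_of_notMem {X : Type*} {f : X → X} (hf : Function.Injective f)
    {U : Set X} (hU : ∀ x ∉ U, f x = x) {x : X} : f x ∈ U ↔ x ∈ U := by
  constructor
  · exact fun hx => by_contra fun h => h (hU x h ▸ hx)
  · exact fun hx => by_contra fun h => h ((hf (hU _ h)).symm ▸ hx)

section Topology

variable {X Y : Type*} [TopologicalSpace X] [TopologicalSpace Y]

theorem isOpen_image_of_subset {f : X → Y} (hf : Topology.IsInducing f) {U V : Set X}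
    (hU : IsOpen (f '' U)) (hV : IsOpen V) (hVU : V ⊆ U) : IsOpen (f '' V) := by
  obtain ⟨W, hW, rfl⟩ := hf.isOpen_iff.1 hV
  have himage : f '' (f ⁻¹' W) = W ∩ f '' U := by
    rw [Set.inter_comm, ← Set.image_inter_preimage, Set.inter_eq_right.2 hVU]
  exact himage ▸ hW.inter hU

theorem continuousOn_of_comp_isQuotientMap {Z : Type*} [TopologicalSpace Z] {f : X → Y}
    (hf : Topology.IsQuotientMap f) {g : Y → Z} {K : Set Y} (hK : IsClosed K)
    (hgf : ContinuousOn (g ∘ f) (f ⁻¹' K)) : ContinuousOn g K := by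
  rw [continuousOn_iff_isClosed]
  intro C hC
  refine ⟨K ∩ g ⁻¹' C, hf.isClosed_preimage.1 ?_, by
    rw [Set.inter_right_comm, Set.inter_self, Set.inter_comm]⟩
  exact hgf.preimage_isClosed_of_isClosed (hK.preimage hf.continuous) hC

theorem isClosedMap_domRestrict_of_continuousOn_symm (e : X ≃ Y) {K : Set X} (hK : IsClosed K)
    (heK : IsClosed (e '' K)) (he : ContinuousOn e.symm (e '' K)) :
    IsClosedMap fun x : K => e x := by
  intro C hC
  have himage : (fun x : K => e x) '' C = e '' K ∩ e.symm ⁻¹' (Subtype.val '' C) := by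
    rw [← Equiv.image_eq_preimage_symm, ← Set.image_inter e.injective,
      Set.inter_eq_right.2 (Subtype.coe_image_subset K C), Set.image_image]
  exact himage ▸ he.preimage_isClosed_of_isClosed heK (hK.isClosedMap_subtype_val C hC)

theorem exists_homeomorph_quot {r : X → X → Prop} {f : X → Y} (hf : Topology.IsQuotientMap f)
    (hr : ∀ a b, r a b → f a = f b) (hfr : ∀ a b, f a = f b → Quot.mk r a = Quot.mk r b) :
    ∃ Φ : Quot r ≃ₜ Y, ∀ a, Φ (Quot.mk r a) = f a := by
  have hquot : Topology.IsQuotientMap (Quot.lift f hr) :=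
    .of_comp continuous_quot_mk (continuous_quot_lift hr hf.continuous) hf
  have hinj : Function.Injective (Quot.lift f hr) := by
    rintro ⟨a⟩ ⟨b⟩ hab
    exact hfr a b hab
  exact ⟨(isHomeomorph_iff_isQuotientMap_injective.2 ⟨hquot, hinj⟩).homeomorph _, fun _ => rfl⟩

end Topology

/-! ### Regluing along a level -/

section ApplyBelow

variable {X I : Type*} [TopologicalSpace X] [LinearOrder I]

/-- The result of cutting `X × I` along the level `t₀` and regluing by `T`, as a bijection of
`X × I`: it applies `T` strictly below the level and is the identity above it and on it. -/
def applyBelow (T : X ≃ₜ X) (t₀ : I) : X × I ≃ X × I where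
  toFun p := (if t₀ ≤ p.2 then p.1 else T p.1, p.2)
  invFun p := (if t₀ ≤ p.2 then p.1 else T⁻¹ p.1, p.2)
  left_inv p := by by_cases hp : t₀ ≤ p.2 <;> simp [hp]
  right_inv p := by by_cases hp : t₀ ≤ p.2 <;> simp [hp]

variable (T : X ≃ₜ X) {t₀ : I} {p : X × I}

theorem applyBelow_symm : (applyBelow T t₀).symm = applyBelow T⁻¹ t₀ := rfl

theorem applyBelow_of_le (hp : t₀ ≤ p.2) : applyBelow T t₀ p = p :=
  Prod.ext (if_pos hp) rfl

theorem applyBelow_of_lt (hp : p.2 < t₀) : applyBelow T t₀ p = Prod.map T id p :=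
  Prod.ext (if_neg hp.not_ge) rfl

variable {T}

theorem applyBelow_of_fixed (hp : T p.1 = p.1) : applyBelow T t₀ p = p := by
  rcases le_or_gt t₀ p.2 with h | h
  · exact applyBelow_of_le T h
  · exact (applyBelow_of_lt T h).trans (Prod.ext hp rfl)

theorem fst_applyBelow_mem {U : Set X} (hU : ∀ x ∈ U, T x ∈ U) (hp : p.1 ∈ U) :
    (applyBelow T t₀ p).1 ∈ U := by
  rcases le_or_gt t₀ p.2 with h | h
  · rwa [applyBelow_of_le T h]
  · rw [applyBelow_of_lt T h]
    exact hU _ hp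

variable [TopologicalSpace I] [OrderClosedTopology I]

theorem isOpen_image_applyBelow {W : Set (X × I)} (hW : IsOpen W)
    (hWT : ∀ x, (T x, t₀) ∈ W ↔ (x, t₀) ∈ W) : IsOpen (applyBelow T t₀ '' W) := by
  have hWT_symm : ∀ x, (T.symm x, t₀) ∈ W ↔ (x, t₀) ∈ W := fun x => by
    rw [← hWT, T.apply_symm_apply]
  have himage : applyBelow T t₀ '' W =
      (W ∪ {p | p.2 < t₀}) ∩ (Prod.map (T⁻¹ : X ≃ₜ X) id ⁻¹' W ∪ {p | t₀ < p.2}) := by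
    ext ⟨x, t⟩
    rw [Set.mem_image_equiv, applyBelow_symm]
    rcases lt_trichotomy t t₀ with h | rfl | h
    · simp [applyBelow_of_lt _ (show (x, t).2 < t₀ from h), h, h.not_gt]
    · simp [applyBelow_of_le _ (show t ≤ (x, t).2 from le_rfl), hWT_symm]
    · simp [applyBelow_of_le _ (show t₀ ≤ (x, t).2 from h.le), h, h.not_gt]
  rw [himage]
  exact (hW.union (isOpen_lt continuous_snd continuous_const)).inter
    ((hW.preimage (T⁻¹.continuous.prodMap continuous_id)).union
      (isOpen_lt continuous_const continuous_snd))

theorem continuousOn_applyBelow {K : Set (X × I)} (hK : IsClosed K)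
    (hKT : ∀ x, (x, t₀) ∈ K → T x = x) : ContinuousOn (applyBelow T t₀) K := by
  have habove : ContinuousOn (applyBelow T t₀) (K ∩ {p | t₀ ≤ p.2}) :=
    continuousOn_id.congr fun p hp => applyBelow_of_le T hp.2
  have hbelow : ContinuousOn (applyBelow T t₀) (K ∩ {p | p.2 ≤ t₀}) := by
    refine (T.continuous.prodMap continuous_id).continuousOn.congr ?_
    rintro ⟨x, t⟩ ⟨hxK, ht⟩
    rcases (show t ≤ t₀ from ht).lt_or_eq with h | rfl
    · exact applyBelow_of_lt T h
    · rw [applyBelow_of_le T (show t ≤ (x, t).2 from le_rfl), Prod.map_apply, hKT x hxK, id]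
  refine (habove.union_of_isClosed hbelow (hK.inter (isClosed_le continuous_const continuous_snd))
    (hK.inter (isClosed_le continuous_snd continuous_const))).mono fun p hp => ?_
  exact (le_total t₀ p.2).imp (fun h => ⟨hp, h⟩) fun h => ⟨hp, h⟩

end ApplyBelow

/-! ### The disc and the solid torus -/

namespace Disc

theorem norm_le_one (z : Disc) : ‖(z : ℂ)‖ ≤ 1 :=
  mem_closedBall_zero_iff.1 z.2

@[simp] theorem coe_polar (r : unitInterval) (w : Circle) :
    (polar r w : ℂ) = ((r : ℝ) : ℂ) * (w : ℂ) := rfl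

@[simp] theorem coe_ofCircle (w : Circle) : (ofCircle w : ℂ) = w := by
  simp [ofCircle]

@[simp] theorem coe_ofReal (s : Set.Icc (-1 : ℝ) 1) : (ofReal s : ℂ) = ((s : ℝ) : ℂ) := rfl

theorem norm_polar (r : unitInterval) (w : Circle) : ‖(polar r w : ℂ)‖ = r := by
  rw [coe_polar, norm_mul, Circle.norm_coe, mul_one, Complex.norm_of_nonneg r.2.1]

theorem continuous_polar : Continuous fun p : unitInterval × Circle => polar p.1 p.2 :=
  Continuous.subtype_mk (by fun_prop) _

theorem ofCircle_mul (v w : Circle) : ofCircle (v * w) = ofCircle v * ofCircle w :=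
  Subtype.ext (by simp)

theorem isClosedEmbedding_ofCircle : Topology.IsClosedEmbedding ofCircle :=
  (continuous_polar.comp (Continuous.prodMk_right 1)).isClosedEmbedding fun v w h =>
    Circle.ext (by simpa using congrArg Subtype.val h)

theorem exists_eq_ofCircle {z : Disc} (hz : ‖(z : ℂ)‖ = 1) : ∃ w, z = ofCircle w :=
  ⟨⟨z, mem_sphere_zero_iff_norm.2 hz⟩, Subtype.ext (coe_ofCircle ⟨z, _⟩).symm⟩

theorem exists_eq_ofReal {z : Disc} (hz : (z : ℂ).im = 0) : ∃ s, z = ofReal s :=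
  ⟨⟨(z : ℂ).re, abs_le.1 ((Complex.abs_re_le_norm _).trans z.norm_le_one)⟩,
    Subtype.ext (Complex.ext rfl hz)⟩

/-- Multiplication by `c` on the disc. -/
def scale (c : Set.Ioc (0 : ℝ) 1) (z : Disc) : Disc :=
  ⟨(c : ℝ) * (z : ℂ), mem_closedBall_zero_iff.2 <| by
    rw [norm_mul, Complex.norm_of_nonneg c.2.1.le]
    exact mul_le_one₀ c.2.2 (norm_nonneg _) z.norm_le_one⟩

theorem continuous_scale (c : Set.Ioc (0 : ℝ) 1) : Continuous (scale c) :=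
  Continuous.subtype_mk (by fun_prop) _

theorem injective_scale (c : Set.Ioc (0 : ℝ) 1) : Function.Injective (scale c) := fun _ _ h =>
  Subtype.ext (mul_left_cancel₀ (Complex.ofReal_ne_zero.2 c.2.1.ne') (congrArg Subtype.val h))

theorem norm_scale (c : Set.Ioc (0 : ℝ) 1) (z : Disc) :
    ‖(scale c z : ℂ)‖ = c * ‖(z : ℂ)‖ := by
  rw [scale, norm_mul, Complex.norm_of_nonneg c.2.1.le]

theorem im_scale (c : Set.Ioc (0 : ℝ) 1) (z : Disc) : (scale c z : ℂ).im = c * (z : ℂ).im :=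
  Complex.im_ofReal_mul _ _

theorem exists_eq_scale {c : Set.Ioc (0 : ℝ) 1} {z : Disc} (hz : ‖(z : ℂ)‖ ≤ c) :
    ∃ w, z = scale c w := by
  have hz' : ‖(z : ℂ) / (c : ℝ)‖ ≤ 1 := by
    rw [norm_div, Complex.norm_of_nonneg c.2.1.le]
    exact (div_le_one c.2.1).2 hz
  exact ⟨⟨z / (c : ℝ), mem_closedBall_zero_iff.2 hz'⟩,
    Subtype.ext (mul_div_cancel₀ _ (Complex.ofReal_ne_zero.2 c.2.1.ne')).symm⟩

theorem image_scale (c : Set.Ioc (0 : ℝ) 1) :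
    Prod.map id (scale c) '' {p : SolidTorus | ‖(p.2 : ℂ)‖ < 1} = {p | ‖(p.2 : ℂ)‖ < c} := by
  ext ⟨u, z⟩
  constructor
  · rintro ⟨⟨v, w⟩, hw, hvw⟩
    obtain ⟨rfl, rfl⟩ := Prod.ext_iff.1 hvw
    exact (norm_scale c w).trans_lt (mul_lt_of_lt_one_right c.2.1 hw)
  · intro hz
    obtain ⟨w, rfl⟩ := exists_eq_scale hz.le
    exact ⟨(u, w), (mul_lt_iff_lt_one_right c.2.1).1 ((norm_scale c w).symm.trans_lt hz), rfl⟩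

theorem exists_homeomorph_ofCircle_zpow (d : ℤˣ) :
    ∃ J : Disc ≃ₜ Disc, (∀ z, ‖(J z : ℂ)‖ = ‖(z : ℂ)‖) ∧
      ∀ w, J (ofCircle w) = ofCircle (w ^ (d : ℤ)) := by
  rcases Int.units_eq_one_or d with rfl | rfl
  · exact ⟨.refl _, fun _ => rfl, fun w => by simp⟩
  · refine ⟨Complex.conjLIE.toHomeomorph.subtype fun z => by simp,
      fun z => Complex.conjLIE.norm_map z, fun w => Subtype.ext ?_⟩
    change starRingEnd ℂ (ofCircle w) = ofCircle (w ^ ((-1 : ℤˣ) : ℤ))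
    rw [coe_ofCircle, coe_ofCircle, Units.val_neg, Units.val_one, zpow_neg_one,
      Circle.coe_inv_eq_conj]

end Disc

/-- The automorphism `u ↦ u ^ e` of the circle, for `e = ±1`. -/
def circleZPow (e : ℤˣ) : Circle ≃ₜ Circle where
  toFun u := u ^ (e : ℤ)
  invFun u := u ^ (e⁻¹ : ℤˣ).val
  left_inv u := (zpow_mul u _ _).symm.trans (by rw [Units.mul_inv, zpow_one])
  right_inv u := (zpow_mul u _ _).symm.trans (by rw [Units.inv_mul, zpow_one])

namespace SolidTorus

/-- The bijection `(u, z) ↦ (u g(z), z)` of the solid torus. -/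
def shear (g : Disc → Circle) : SolidTorus ≃ SolidTorus where
  toFun p := (p.1 * g p.2, p.2)
  invFun p := (p.1 * (g p.2)⁻¹, p.2)
  left_inv p := by simp only [mul_inv_cancel_right]
  right_inv p := by simp only [inv_mul_cancel_right]

theorem shear_apply (g : Disc → Circle) (p : SolidTorus) :
    shear g p = (p.1 * g p.2, p.2) := rfl

theorem shear_symm_apply (g : Disc → Circle) (p : SolidTorus) :
    (shear g).symm p = (p.1 * (g p.2)⁻¹, p.2) := rfl

/-- The shear by a continuous function. -/
def shearHomeomorph (g : C(Disc, Circle)) : SolidTorus ≃ₜ SolidTorus where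
  toEquiv := shear g
  continuous_toFun := (continuous_fst.mul (g.continuous.comp continuous_snd)).prodMk continuous_snd
  continuous_invFun :=
    (continuous_fst.mul (g.continuous.comp continuous_snd).inv).prodMk continuous_snd

/-- The extension `(u, z) ↦ (u e^{q π i (Re z + 1)}, z)` to the solid torus of the `q`-th power of
the Dehn twist of the horizontal annulus. -/
def turn (q : ℤ) : SolidTorus ≃ₜ SolidTorus :=
  shearHomeomorph ⟨fun z => Circle.exp (Real.pi * ((z : ℂ).re + 1)) ^ q, by fun_prop⟩

theorem turn_ofReal (q : ℤ) (u : Circle) (s : Set.Icc (-1 : ℝ) 1) :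
    turn q (u, Disc.ofReal s) =
      Prod.map id Disc.ofReal (AnnularNbhd.modelTwist q (u, s)) :=
  Prod.ext (congrArg (u * ·) (Circle.exp_intCast_mul _ q).symm) rfl

/-- The homeomorphism `(u, z) ↦ (u, uⁿ z)` of the solid torus. -/
def fiberRotation (n : ℤ) : SolidTorus ≃ₜ SolidTorus where
  toFun p := (p.1, Disc.ofCircle (p.1 ^ n) * p.2)
  invFun p := (p.1, Disc.ofCircle (p.1 ^ (-n)) * p.2)
  left_inv p := by
    refine Prod.ext rfl (Subtype.ext ?_)
    simp [-Circle.coe_zpow]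
  right_inv p := by
    refine Prod.ext rfl (Subtype.ext ?_)
    simp [-Circle.coe_zpow]
  continuous_toFun := continuous_fst.prodMk
    ((Disc.isClosedEmbedding_ofCircle.continuous.comp (by fun_prop)).mul continuous_snd)
  continuous_invFun := continuous_fst.prodMk
    ((Disc.isClosedEmbedding_ofCircle.continuous.comp (by fun_prop)).mul continuous_snd)

/-- The angle, as a function of the point of the meridian disc, through which the lower half of the
solid torus is turned by the Dehn twist applied below the page. It jumps at the horizontal
diameter, where the Dehn twist takes place. -/
def lowerPhase (z : ℂ) : Circle :=
  if 0 ≤ z.im then 1 else Circle.exp (Real.pi * (z.re + 1))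

theorem lowerPhase_of_nonneg {z : ℂ} (hz : 0 ≤ z.im) : lowerPhase z = 1 := if_pos hz

theorem lowerPhase_of_neg {z : ℂ} (hz : z.im < 0) :
    lowerPhase z = Circle.exp (Real.pi * (z.re + 1)) := if_neg hz.not_ge

theorem exp_arccos_re {w : Circle} (hw : 0 ≤ (w : ℂ).im) :
    Circle.exp (Real.arccos (w : ℂ).re) = w := by
  have harg : Real.arccos (w : ℂ).re = (w : ℂ).arg := by
    rw [Complex.arg_of_im_nonneg_of_ne_zero hw w.coe_ne_zero, Circle.norm_coe, div_one]
  rw [harg, Circle.exp_arg]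

theorem exp_neg_arccos_re {w : Circle} (hw : (w : ℂ).im < 0) :
    Circle.exp (-Real.arccos (w : ℂ).re) = w := by
  have harg : -Real.arccos (w : ℂ).re = (w : ℂ).arg := by
    rw [Complex.arg_of_im_neg hw, Circle.norm_coe, div_one]
  rw [harg, Circle.exp_arg]

theorem re_eq_one_or_neg_one {w : Circle} (hw : (w : ℂ).im = 0) :
    (w : ℂ).re = 1 ∨ (w : ℂ).re = -1 := by
  have h := Circle.normSq_coe w
  rw [Complex.normSq_apply, hw, mul_zero, add_zero] at h
  exact mul_self_eq_one_iff.1 h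

theorem exists_lowerPhase_eq :
    ∃ δ : C(Circle, ℝ), ∀ w : Circle, lowerPhase w = w * Circle.exp (δ w) := by
  have hre : Continuous fun w : Circle => (w : ℂ).re :=
    Complex.continuous_re.comp continuous_subtype_val
  have hcont : Continuous fun w : Circle => if 0 ≤ (w : ℂ).im then -Real.arccos (w : ℂ).re
      else Real.pi * ((w : ℂ).re - 1) + Real.arccos (w : ℂ).re := by
    refine Continuous.if_le (Real.continuous_arccos.comp hre).neg
      ((continuous_const.mul (hre.sub continuous_const)).add (Real.continuous_arccos.comp hre))
      continuous_const (Complex.continuous_im.comp continuous_subtype_val) fun w hw => ?_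
    rcases re_eq_one_or_neg_one hw.symm with h | h <;> rw [h]
    · rw [Real.arccos_one, sub_self, mul_zero, neg_zero, add_zero]
    · rw [Real.arccos_neg_one]
      ring
  refine ⟨⟨_, hcont⟩, fun w => ?_⟩
  change _ = w * Circle.exp (if 0 ≤ (w : ℂ).im then _ else _)
  split_ifs with hw
  · rw [lowerPhase_of_nonneg hw, Circle.exp_neg, exp_arccos_re hw, mul_inv_cancel]
  · rw [lowerPhase_of_neg (not_le.1 hw)]
    nth_rw 2 [← exp_neg_arccos_re (not_le.1 hw)]
    rw [← Circle.exp_add, Circle.exp_eq_exp]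
    exact ⟨1, by push_cast; ring⟩

theorem continuous_lowerPhase : Continuous fun w : Circle => lowerPhase w := by
  obtain ⟨δ, hδ⟩ := exists_lowerPhase_eq
  exact (by fun_prop : Continuous fun w => w * Circle.exp (δ w)).congr fun w => (hδ w).symm

/-- The Dehn twist applied below the page, in the coordinates of a regular neighbourhood. -/
def lowerTwist (q : ℤ) : SolidTorus ≃ SolidTorus := shear fun z => lowerPhase z ^ q

theorem lowerTwist_symm_of_nonneg (q : ℤ) {p : SolidTorus} (hp : 0 ≤ (p.2 : ℂ).im) :
    (lowerTwist q).symm p = p := by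
  rw [lowerTwist, shear_symm_apply, lowerPhase_of_nonneg hp, one_zpow, inv_one, mul_one]

theorem lowerTwist_symm_of_neg (q : ℤ) {p : SolidTorus} (hp : (p.2 : ℂ).im < 0) :
    (lowerTwist q).symm p = (turn q).symm p := by
  rw [lowerTwist, shear_symm_apply, lowerPhase_of_neg hp]
  rfl

theorem exists_homeomorph_extending_lowerTwist {B : Matrix (Fin 2) (Fin 2) ℤ} {q : ℤ}
    (hB : IsGluingOfSlope B (-1, q)) :
    ∃ Ψ : SolidTorus ≃ₜ SolidTorus, (∀ p, ‖((Ψ p).2 : ℂ)‖ = ‖(p.2 : ℂ)‖) ∧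
      ∀ u w, Ψ (u, Disc.ofCircle w) =
        lowerTwist q (Prod.map id Disc.ofCircle (linearTorusMap B (u, w))) := by
  obtain ⟨d, e, hd, hdq, he⟩ := hB.exists_units
  obtain ⟨J, hJ_norm, hJ⟩ := Disc.exists_homeomorph_ofCircle_zpow d
  obtain ⟨δ, hδ⟩ := exists_lowerPhase_eq
  obtain ⟨Δ, hΔ⟩ := ContinuousMap.exists_extension Disc.isClosedEmbedding_ofCircle δ
  have hΔ_apply : ∀ w, Δ (Disc.ofCircle w) = δ w := DFunLike.congr_fun hΔ
  refine ⟨((Homeomorph.refl _).prodCongr J).trans <| (fiberRotation (B 1 0)).trans <|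
    ((circleZPow e).prodCongr (.refl _)).trans
      (shearHomeomorph ⟨fun z => Circle.exp (Δ z) ^ q, by fun_prop⟩), fun p => ?_, fun u w => ?_⟩
  · change ‖((Disc.ofCircle (p.1 ^ B 1 0) * J p.2 : Disc) : ℂ)‖ = _
    rw [Metric.unitClosedBall.coe_mul, norm_mul, Disc.coe_ofCircle, Circle.norm_coe, one_mul,
      hJ_norm]
  · change shear (fun z => Circle.exp (Δ z) ^ q)
      (u ^ (e : ℤ), Disc.ofCircle (u ^ B 1 0) * J (Disc.ofCircle w)) = _
    rw [hJ, ← hd, ← Disc.ofCircle_mul, ← he, shear_apply, lowerTwist, shear_apply, hΔ_apply]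
    refine Prod.ext ?_ rfl
    simp only [linearTorusMap, Prod.map_apply, id, Disc.coe_ofCircle, hδ, mul_zpow,
      ← mul_assoc]
    congr 1
    -- the shear by `w ^ q` cancels the exponent of `w` in the gluing, as `B 0 1 + B 1 1 * q = 0`
    rw [← zpow_mul, ← zpow_mul, zpow_add, mul_right_comm _ (w ^ B 0 1), mul_assoc _ (w ^ B 0 1),
      ← zpow_add w, hd, hdq, zpow_zero, mul_one]

end SolidTorus

section Surface

variable {S : Type*} [TopologicalSpace S] [ChartedSpace (EuclideanHalfSpace 2) S]

/-! ### Concentric annuli and powers of the Dehn twist -/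

namespace AnnularNbhd

variable {γ : Circle → S} (A : AnnularNbhd γ)

/-- Multiplication by `c` on `[-1, 1]`. -/
def scale (c : Set.Ioc (0 : ℝ) 1) (s : Set.Icc (-1 : ℝ) 1) : Set.Icc (-1 : ℝ) 1 :=
  ⟨c * s, abs_le.1 <| by
    rw [abs_mul, abs_of_pos c.2.1]
    exact mul_le_one₀ c.2.2 (abs_nonneg _) (abs_le.2 s.2)⟩

theorem injective_scale (c : Set.Ioc (0 : ℝ) 1) : Function.Injective (scale c) := fun _ _ h =>
  Subtype.ext (mul_left_cancel₀ c.2.1.ne' (congrArg Subtype.val h))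

theorem image_scale (c : Set.Ioc (0 : ℝ) 1) :
    Prod.map id (scale c) '' {p : Circle × Set.Icc (-1 : ℝ) 1 | |(p.2 : ℝ)| < 1} =
      {p | |(p.2 : ℝ)| < c} := by
  ext ⟨u, s⟩
  constructor
  · rintro ⟨⟨v, t⟩, ht, hvt⟩
    obtain ⟨rfl, rfl⟩ := Prod.ext_iff.1 hvt
    change |(c : ℝ) * t| < c
    rw [abs_mul, abs_of_pos c.2.1]
    exact mul_lt_of_lt_one_right c.2.1 ht
  · intro hs
    have hs' : |(s : ℝ) / c| < 1 := by
      rw [abs_div, abs_of_pos c.2.1]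
      exact (div_lt_one c.2.1).2 hs
    exact ⟨(u, ⟨s / c, abs_le.1 hs'.le⟩), hs',
      Prod.ext rfl (Subtype.ext (mul_div_cancel₀ _ c.2.1.ne'))⟩

/-- The concentric annulus of relative width `c`. -/
def shrink [T2Space S] (c : Set.Ioc (0 : ℝ) 1) : AnnularNbhd γ where
  toFun := A.toFun ∘ Prod.map id (scale c)
  continuous_toFun := A.continuous_toFun.comp
    (continuous_id.prodMap (Continuous.subtype_mk (by fun_prop) _))
  injective_toFun := A.injective_toFun.comp (Function.injective_id.prodMap (injective_scale c))
  isOpen_image := by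
    rw [Set.image_comp, image_scale]
    exact isOpen_image_of_subset
      (A.continuous_toFun.isClosedEmbedding A.injective_toFun).isInducing A.isOpen_image
      (isOpen_lt (by fun_prop) continuous_const) fun p hp => hp.trans_le c.2.2
  mem_interior p := A.mem_interior _
  core u := (congrArg (fun s => A.toFun (u, s)) (Subtype.ext (mul_zero (c : ℝ)))).trans (A.core u)

theorem shrink_isShrinkingOf [T2Space S] (c : Set.Ioc (0 : ℝ) 1) :
    (A.shrink c).IsShrinkingOf A :=
  ⟨c, c.2.1, c.2.2, fun u _ _ hs =>
    congrArg (fun s => A.toFun (u, s)) (Subtype.ext hs.symm)⟩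

theorem modelTwist_add (m n : ℤ) (p : Circle × Set.Icc (-1 : ℝ) 1) :
    modelTwist (m + n) p = modelTwist m (modelTwist n p) := by
  refine Prod.ext ?_ rfl
  simp only [modelTwist]
  rw [mul_assoc, ← Circle.exp_add, Int.cast_add, add_mul, add_comm]

theorem twistFun_add (m n : ℤ) (x : S) :
    A.twistFun (m + n) x = A.twistFun m (A.twistFun n x) := by
  by_cases hx : x ∈ Set.range A.toFun
  · obtain ⟨p, rfl⟩ := hx
    simp only [twistFun_apply, modelTwist_add]
  · simp only [A.twistFun_of_notMem _ hx]

variable [T2Space S]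

theorem coe_dehnTwist_zpow (n : ℤ) : ⇑(A.dehnTwist ^ n) = A.twistFun n := by
  induction n with
  | zero =>
    funext x
    exact (A.twistFun_neg 0 x).symm.trans (A.twistFun_add (-0) 0 x).symm
  | succ n ih =>
    funext x
    rw [zpow_add_one, Homeomorph.mul_apply, ih, twistFun_add]
    rfl
  | pred n ih =>
    funext x
    rw [zpow_sub_one, Homeomorph.mul_apply, ih, sub_eq_add_neg, twistFun_add]
    rfl

theorem dehnTwist_zpow_toFun (n : ℤ) (p : Circle × Set.Icc (-1 : ℝ) 1) :
    (A.dehnTwist ^ n) (A.toFun p) = A.toFun (modelTwist n p) := by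
  rw [coe_dehnTwist_zpow, twistFun_apply]

theorem dehnTwist_zpow_of_notMem (n : ℤ) {x : S} (hx : x ∉ A.toFun '' {p | |(p.2 : ℝ)| < 1}) :
    (A.dehnTwist ^ n) x = x := by
  rw [coe_dehnTwist_zpow, A.twistFun_eqOn n hx]

theorem dehnTwist_zpow_mem_image_iff (n : ℤ) (x : S) :
    (A.dehnTwist ^ n) x ∈ A.toFun '' {p | |(p.2 : ℝ)| < 1} ↔
      x ∈ A.toFun '' {p | |(p.2 : ℝ)| < 1} :=
  apply_mem_iff_of_fixed_of_notMem (A.dehnTwist ^ n).injective fun _ => A.dehnTwist_zpow_of_notMem n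

theorem dehnTwist_zpow_of_mem_boundary (n : ℤ) {x : S} (hx : x ∈ (𝓡∂ 2).boundary S) :
    (A.dehnTwist ^ n) x = x := by
  refine A.dehnTwist_zpow_of_notMem n ?_
  rintro ⟨p, -, rfl⟩
  exact Set.disjoint_left.1 (𝓡∂ 2).disjoint_interior_boundary (A.mem_interior p) hx

theorem dehnTwist_zpow_mem_interior (n : ℤ) {x : S} (hx : x ∈ (𝓡∂ 2).interior S) :
    (A.dehnTwist ^ n) x ∈ (𝓡∂ 2).interior S := by
  refine (apply_mem_iff_of_fixed_of_notMem (A.dehnTwist ^ n).injective fun y hy => ?_).2 hx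
  exact A.dehnTwist_zpow_of_mem_boundary n ((𝓡∂ 2).compl_interior.subset hy)

end AnnularNbhd

/-! ### Regluing an open book -/

namespace OpenBook

theorem isQuotientMap_mk (h : S ≃ₜ S) : Topology.IsQuotientMap (mk h) := isQuotientMap_quot_mk

theorem eq_of_mk_eq (h : S ≃ₜ S) {p p' : S × unitInterval} (hp : p.1 ∈ (𝓡∂ 2).interior S)
    (h0 : 0 < p.2) (h1 : p.2 < 1) (hpp' : mk h p' = mk h p) : p' = p := by
  have hrel : ∀ a b, OpenBookRel h a b → (a = p) = (b = p) := by
    rintro _ _ (x | ⟨x, hx, t, t'⟩)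
    · refine propext ⟨?_, ?_⟩ <;> rintro rfl
      exacts [absurd h1 (lt_irrefl _), absurd h0 (lt_irrefl _)]
    · have hxp : x ≠ p.1 := fun hx' =>
        Set.disjoint_left.1 (𝓡∂ 2).disjoint_interior_boundary (hx' ▸ hp) hx
      refine propext ⟨?_, ?_⟩ <;> rintro rfl <;> exact absurd rfl hxp
  have hlift : Quot.lift (· = p) hrel (mk h p') = Quot.lift (· = p) hrel (mk h p) :=
    congrArg _ hpp'
  exact hlift.mpr rfl

variable {t₀ : unitInterval} (ht₀ : 0 < t₀) {h T : S ≃ₜ S}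
  (hT : ∀ x ∈ (𝓡∂ 2).boundary S, T x = x)

include ht₀ hT in
theorem openBookRel_applyBelow {a b : S × unitInterval} (hab : OpenBookRel h a b) :
    OpenBookRel (T * h) (applyBelow T t₀ a) (applyBelow T t₀ b) := by
  obtain x | ⟨x, hx, t, t'⟩ := hab
  · rw [applyBelow_of_le T unitInterval.le_one', applyBelow_of_lt T ht₀]
    exact .monodromy x
  · rw [applyBelow_of_fixed (hT x hx), applyBelow_of_fixed (hT x hx)]
    exact .binding x hx t t'

variable (h)

/-- Cutting the open book along the page `S × {t₀}` and regluing by `T` composes the monodromy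
with `T`: the resulting bijection, which is discontinuous at those points of the page that `T`
moves. -/
def changeMonodromy : OpenBook h ≃ OpenBook (T * h) :=
  Quot.congr (applyBelow T t₀) fun a b => by
    refine ⟨openBookRel_applyBelow ht₀ hT, fun hab => ?_⟩
    have hT_inv : ∀ x ∈ (𝓡∂ 2).boundary S, T⁻¹ x = x := fun x hx =>
      T.symm_apply_eq.2 (hT x hx).symm
    have hab' := openBookRel_applyBelow ht₀ hT_inv hab
    rwa [inv_mul_cancel_left, ← applyBelow_symm, Equiv.symm_apply_apply,
      Equiv.symm_apply_apply] at hab'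

theorem changeMonodromy_mk (p : S × unitInterval) :
    changeMonodromy ht₀ h hT (mk h p) = mk (T * h) (applyBelow T t₀ p) := rfl

theorem continuousOn_changeMonodromy {K : Set (OpenBook h)} (hK : IsClosed K)
    (hKT : ∀ x, mk h (x, t₀) ∈ K → T x = x) :
    ContinuousOn (changeMonodromy ht₀ h hT) K :=
  continuousOn_of_comp_isQuotientMap (isQuotientMap_mk h) hK <|
    (isQuotientMap_mk (T * h)).continuous.comp_continuousOn <|
      continuousOn_applyBelow (hK.preimage (isQuotientMap_mk h).continuous) hKT

theorem continuousOn_changeMonodromy_symm {K : Set (OpenBook (T * h))} (hK : IsClosed K)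
    (hKT : ∀ x, mk (T * h) (x, t₀) ∈ K → T x = x) :
    ContinuousOn (changeMonodromy ht₀ h hT).symm K :=
  continuousOn_of_comp_isQuotientMap (isQuotientMap_mk (T * h)) hK <|
    (isQuotientMap_mk h).continuous.comp_continuousOn <|
      continuousOn_applyBelow (T := T⁻¹) (hK.preimage (isQuotientMap_mk (T * h)).continuous)
        fun x hx => T.symm_apply_eq.2 (hKT x hx).symm

end OpenBook

/-! ### Regular neighbourhoods -/

namespace RegularNbhd

variable {γ : Circle → S} {A : AnnularNbhd γ} {t₀ : unitInterval} (N : RegularNbhd A t₀)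

include N in
theorem zero_lt_level : 0 < t₀ := by
  have hpos := N.level_pos (1, Disc.ofReal ⟨0, by norm_num⟩)
  rwa [N.page] at hpos

theorem le_level {p : SolidTorus} (hp : 0 ≤ (p.2 : ℂ).im) : t₀ ≤ (N.toFun p).2 := by
  obtain ⟨u, z⟩ := p
  rcases hp.lt_or_eq with hz | hz
  · exact (N.above _ hz).le
  · obtain ⟨s, rfl⟩ := Disc.exists_eq_ofReal hz.symm
    rw [N.page]

theorem mk_level_mem_image_iff {x : S} :
    (x, t₀) ∈ N.toFun '' {p | ‖(p.2 : ℂ)‖ < 1} ↔ x ∈ A.toFun '' {p | |(p.2 : ℝ)| < 1} := by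
  constructor
  · rintro ⟨⟨u, z⟩, hz, hp⟩
    have hlevel : (N.toFun (u, z)).2 = t₀ := congrArg Prod.snd hp
    have him : (z : ℂ).im = 0 :=
      le_antisymm (not_lt.1 fun h => (N.above (u, z) h).ne' hlevel)
        (not_lt.1 fun h => (N.below (u, z) h).ne hlevel)
    obtain ⟨s, rfl⟩ := Disc.exists_eq_ofReal him
    rw [N.page] at hp
    exact ⟨(u, s), by simpa using hz, congrArg Prod.fst hp⟩
  · rintro ⟨⟨u, s⟩, hs, rfl⟩
    exact ⟨(u, Disc.ofReal s), by simpa using hs, N.page u s⟩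

/-- The parametrization of the neighbourhood as a subset of the manifold. -/
def toOpenBook (h : S ≃ₜ S) (p : SolidTorus) : OpenBook h := OpenBook.mk h (N.toFun p)

theorem mk_eq_toOpenBook_iff (h : S ≃ₜ S) {x : S × unitInterval} {p : SolidTorus} :
    OpenBook.mk h x = N.toOpenBook h p ↔ x = N.toFun p :=
  ⟨OpenBook.eq_of_mk_eq h (N.mem_interior p) (N.level_pos p) (N.level_lt_one p), congrArg _⟩

theorem injective_toOpenBook (h : S ≃ₜ S) : Function.Injective (N.toOpenBook h) := fun _ _ hp =>
  N.injective_toFun ((N.mk_eq_toOpenBook_iff h).1 hp)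

theorem continuous_toOpenBook (h : S ≃ₜ S) : Continuous (N.toOpenBook h) :=
  (OpenBook.isQuotientMap_mk h).continuous.comp N.continuous_toFun

theorem preimage_mk_image (h : S ≃ₜ S) (K : Set SolidTorus) :
    OpenBook.mk h ⁻¹' (N.toOpenBook h '' K) = N.toFun '' K := by
  ext x
  simp only [Set.mem_preimage, Set.mem_image, @eq_comm _ _ (OpenBook.mk h x),
    mk_eq_toOpenBook_iff, @eq_comm _ _ x]

theorem isClosedMap_toOpenBook [T2Space S] (h : S ≃ₜ S) : IsClosedMap (N.toOpenBook h) :=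
  fun K hK => by
    rw [← (OpenBook.isQuotientMap_mk h).isClosed_preimage, N.preimage_mk_image]
    exact (N.continuous_toFun.isClosedEmbedding N.injective_toFun).isClosedMap K hK

theorem isOpen_openCarrier (h : S ≃ₜ S) : IsOpen (N.openCarrier h) := by
  rw [← (OpenBook.isQuotientMap_mk h).isOpen_preimage]
  exact (N.preimage_mk_image h _).symm ▸ N.isOpen_image

theorem toOpenBook_mem_openCarrier_iff (h : S ≃ₜ S) {p : SolidTorus} :
    N.toOpenBook h p ∈ N.openCarrier h ↔ ‖(p.2 : ℂ)‖ < 1 :=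
  (N.injective_toOpenBook h).mem_set_image

/-- The concentric solid torus of relative radius `c`. -/
def shrink [T2Space S] (c : Set.Ioc (0 : ℝ) 1) : RegularNbhd (A.shrink c) t₀ where
  toFun := N.toFun ∘ Prod.map id (Disc.scale c)
  continuous_toFun := N.continuous_toFun.comp
    (continuous_id.prodMap (Disc.continuous_scale c))
  injective_toFun := N.injective_toFun.comp
    (Function.injective_id.prodMap (Disc.injective_scale c))
  isOpen_image := by
    rw [Set.image_comp, Disc.image_scale]
    exact isOpen_image_of_subset
      (N.continuous_toFun.isClosedEmbedding N.injective_toFun).isInducing N.isOpen_image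
      (isOpen_lt (by fun_prop) continuous_const) fun p hp => hp.trans_le c.2.2
  mem_interior p := N.mem_interior _
  level_pos p := N.level_pos _
  level_lt_one p := N.level_lt_one _
  page u s := (congrArg (fun z => N.toFun (u, z))
    (Subtype.ext (Complex.ofReal_mul _ _).symm : Disc.scale c (Disc.ofReal s) =
      Disc.ofReal (AnnularNbhd.scale c s))).trans (N.page u _)
  above p hp := N.above _ (by
    rw [Prod.map_snd, Disc.im_scale]
    exact mul_pos c.2.1 hp)
  below p hp := N.below _ (by
    rw [Prod.map_snd, Disc.im_scale]
    exact mul_neg_of_pos_of_neg c.2.1 hp)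

theorem carrier_shrink_subset [T2Space S] (h : S ≃ₜ S) (c : Set.Ioc (0 : ℝ) 1) :
    (N.shrink c).carrier h ⊆ N.carrier h :=
  Set.range_comp_subset_range (Prod.map id (Disc.scale c)) (N.toOpenBook h)

/-! ### The regular neighbourhood after regluing -/

theorem toFun_turn_ofReal [T2Space S] (q : ℤ) (u : Circle) (s : Set.Icc (-1 : ℝ) 1) :
    N.toFun (SolidTorus.turn q (u, Disc.ofReal s)) =
      Prod.map (A.dehnTwist ^ q) id (N.toFun (u, Disc.ofReal s)) := by
  rw [N.page, Prod.map_apply, A.dehnTwist_zpow_toFun, SolidTorus.turn_ofReal]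
  exact N.page _ s

variable [T2Space S] (q : ℤ)

/-- The embedding onto the image of the neighbourhood under the regluing by the Dehn twist. It has
to be precomposed with the inverse of `SolidTorus.lowerTwist` to become continuous. -/
def twistFun : SolidTorus → S × unitInterval :=
  applyBelow (A.dehnTwist ^ q) t₀ ∘ N.toFun ∘ (SolidTorus.lowerTwist q).symm

theorem twistFun_of_nonneg {p : SolidTorus} (hp : 0 ≤ (p.2 : ℂ).im) :
    N.twistFun q p = N.toFun p := by
  rw [twistFun, Function.comp_apply, Function.comp_apply,
    SolidTorus.lowerTwist_symm_of_nonneg q hp, applyBelow_of_le _ (N.le_level hp)]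

theorem twistFun_of_nonpos {p : SolidTorus} (hp : (p.2 : ℂ).im ≤ 0) :
    N.twistFun q p =
      Prod.map (A.dehnTwist ^ q) id (N.toFun ((SolidTorus.turn q).symm p)) := by
  rcases hp.lt_or_eq with hz | hz
  · rw [twistFun, Function.comp_apply, Function.comp_apply,
      SolidTorus.lowerTwist_symm_of_neg q hz]
    exact applyBelow_of_lt _ (N.below ((SolidTorus.turn q).symm p) hz)
  · obtain ⟨⟨v, z⟩, rfl⟩ := (SolidTorus.turn q).surjective p
    obtain ⟨s, rfl⟩ := Disc.exists_eq_ofReal (z := z) hz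
    rw [N.twistFun_of_nonneg q hz.ge, Homeomorph.symm_apply_apply, N.toFun_turn_ofReal]

theorem continuous_twistFun : Continuous (N.twistFun q) := by
  have htwist : N.twistFun q = fun p => if 0 ≤ (p.2 : ℂ).im then N.toFun p else
      Prod.map (A.dehnTwist ^ q) id (N.toFun ((SolidTorus.turn q).symm p)) := by
    funext p
    split_ifs with hp
    exacts [N.twistFun_of_nonneg q hp, N.twistFun_of_nonpos q (not_le.1 hp).le]
  rw [htwist]
  refine Continuous.if_le N.continuous_toFun ?_ continuous_const (by fun_prop) fun p hp => ?_
  · exact ((A.dehnTwist ^ q).continuous.prodMap continuous_id).comp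
      (N.continuous_toFun.comp (SolidTorus.turn q).symm.continuous)
  · rw [← N.twistFun_of_nonpos q hp.ge, N.twistFun_of_nonneg q hp.le]

theorem isOpen_image_twistFun : IsOpen (N.twistFun q '' {p | ‖(p.2 : ℂ)‖ < 1}) := by
  have himage : (SolidTorus.lowerTwist q).symm '' {p | ‖(p.2 : ℂ)‖ < 1} =
      {p | ‖(p.2 : ℂ)‖ < 1} := (SolidTorus.lowerTwist q).image_symm_eq_preimage _
  rw [twistFun, Set.image_comp, Set.image_comp, himage]
  exact isOpen_image_applyBelow N.isOpen_image fun x => by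
    rw [N.mk_level_mem_image_iff, N.mk_level_mem_image_iff, A.dehnTwist_zpow_mem_image_iff]

/-- The image of the neighbourhood under the regluing by the `q`-th power of the Dehn twist. -/
def twist : RegularNbhd A t₀ where
  toFun := N.twistFun q
  continuous_toFun := N.continuous_twistFun q
  injective_toFun := (Equiv.injective _).comp (N.injective_toFun.comp (Equiv.injective _))
  isOpen_image := N.isOpen_image_twistFun q
  mem_interior p :=
    fst_applyBelow_mem (fun _ => A.dehnTwist_zpow_mem_interior q) (N.mem_interior _)
  level_pos p := N.level_pos _
  level_lt_one p := N.level_lt_one _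
  page u s := by rw [N.twistFun_of_nonneg q le_rfl, N.page]
  above p hp := N.above _ hp
  below p hp := N.below _ hp

variable (h : S ≃ₜ S)

/-- The regluing by the `q`-th power of the Dehn twist. -/
def openBookTwist : OpenBook h ≃ OpenBook (A.dehnTwist ^ q * h) :=
  OpenBook.changeMonodromy N.zero_lt_level h fun _ => A.dehnTwist_zpow_of_mem_boundary q

theorem openBookTwist_mk (p : S × unitInterval) :
    N.openBookTwist q h (OpenBook.mk h p) =
      OpenBook.mk _ (applyBelow (A.dehnTwist ^ q) t₀ p) :=
  OpenBook.changeMonodromy_mk _ _ _ _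

theorem openBookTwist_toOpenBook (p : SolidTorus) :
    N.openBookTwist q h (N.toOpenBook h p) =
      (N.twist q).toOpenBook _ (SolidTorus.lowerTwist q p) := by
  change _ = OpenBook.mk _ (applyBelow _ _ (N.toFun ((SolidTorus.lowerTwist q).symm _)))
  rw [Equiv.symm_apply_apply]
  rfl

theorem image_openBookTwist_image (K : Set SolidTorus) :
    N.openBookTwist q h '' (N.toOpenBook h '' K) =
      (N.twist q).toOpenBook _ '' (SolidTorus.lowerTwist q '' K) := by
  simp only [Set.image_image, openBookTwist_toOpenBook]

theorem openBookTwist_image_openCarrier :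
    N.openBookTwist q h '' N.openCarrier h = (N.twist q).openCarrier _ :=
  (N.image_openBookTwist_image q h _).trans <|
    congrArg _ ((SolidTorus.lowerTwist q).image_eq_preimage_symm _)

theorem openBookTwist_image_carrier :
    N.openBookTwist q h '' N.carrier h = (N.twist q).carrier _ := by
  have himage := N.image_openBookTwist_image q h Set.univ
  rwa [Set.image_univ, Set.image_univ_of_surjective (Equiv.surjective _), Set.image_univ] at himage

theorem openBookTwist_mem_carrier_iff {x : OpenBook h} :
    N.openBookTwist q h x ∈ (N.twist q).carrier _ ↔ x ∈ N.carrier h := by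
  rw [← openBookTwist_image_carrier, (Equiv.injective _).mem_set_image]

theorem dehnTwist_zpow_of_mk_notMem_openCarrier {x : S}
    (hx : OpenBook.mk h (x, t₀) ∉ N.openCarrier h) : (A.dehnTwist ^ q) x = x :=
  A.dehnTwist_zpow_of_notMem q fun hxA => hx <| by
    obtain ⟨p, hp, hpx⟩ := N.mk_level_mem_image_iff.2 hxA
    exact ⟨p, hp, congrArg (OpenBook.mk h) hpx⟩

theorem continuousOn_openBookTwist :
    ContinuousOn (N.openBookTwist q h) (N.openCarrier h)ᶜ :=
  OpenBook.continuousOn_changeMonodromy _ _ _ (N.isOpen_openCarrier h).isClosed_compl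
    fun _ => N.dehnTwist_zpow_of_mk_notMem_openCarrier q h

theorem continuousOn_openBookTwist_symm :
    ContinuousOn (N.openBookTwist q h).symm ((N.twist q).openCarrier _)ᶜ :=
  OpenBook.continuousOn_changeMonodromy_symm _ _ _
    ((N.twist q).isOpen_openCarrier _).isClosed_compl
    fun _ => (N.twist q).dehnTwist_zpow_of_mk_notMem_openCarrier q _

end RegularNbhd

/-! ### Surgery -/

theorem Surgery.exists_homeomorph_openBook [T2Space S] {γ γ' : Circle → S} {A : AnnularNbhd γ}
    {A' : AnnularNbhd γ'} {t₀ t₀' : unitInterval} {h h' : S ≃ₜ S} (N : RegularNbhd A t₀)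
    (N' : RegularNbhd A' t₀') (B : Matrix (Fin 2) (Fin 2) ℤ) (c : OpenBook h ≃ OpenBook h')
    (hc : ContinuousOn c (N.openCarrier h)ᶜ) (hc_symm : ContinuousOn c.symm (N'.openCarrier h')ᶜ)
    (hc_image : c '' N.openCarrier h = N'.openCarrier h') (Ψ : SolidTorus ≃ₜ SolidTorus)
    (hΨ : ∀ p, ‖((Ψ p).2 : ℂ)‖ = ‖(p.2 : ℂ)‖)
    (hΨB : ∀ u w, N'.toOpenBook h' (Ψ (u, Disc.ofCircle w)) =
      c (N.boundaryPoint h (linearTorusMap B (u, w)))) :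
    ∃ Φ : Surgery h N B ≃ₜ OpenBook h',
      (∀ x, Φ (ofExterior h N B x) = c x.1) ∧ Φ '' newTorus h N B = N'.carrier h' := by
  let f : N.Exterior h ⊕ SolidTorus → OpenBook h' :=
    Sum.elim (fun x => c x.1) (N'.toOpenBook h' ∘ Ψ)
  have hc_compl : c '' (N.openCarrier h)ᶜ = (N'.openCarrier h')ᶜ := by
    rw [Set.image_compl_eq c.bijective, hc_image]
  have hf_continuous : Continuous f :=
    (continuousOn_iff_continuous_domRestrict.1 hc).sumElim
      ((N'.continuous_toOpenBook h').comp Ψ.continuous)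
  have hf_closed : IsClosedMap f :=
    (isClosedMap_domRestrict_of_continuousOn_symm c (N.isOpen_openCarrier h).isClosed_compl
      (hc_compl ▸ (N'.isOpen_openCarrier h').isClosed_compl) (hc_compl ▸ hc_symm)).sumElim
      ((N'.isClosedMap_toOpenBook h').comp Ψ.isClosedMap)
  have hf_surjective : Function.Surjective f := fun b => by
    by_cases hb : b ∈ N'.openCarrier h'
    · obtain ⟨p, -, rfl⟩ := hb
      exact ⟨.inr (Ψ.symm p), congrArg (N'.toOpenBook h') (Ψ.apply_symm_apply p)⟩
    · obtain ⟨x, hx, rfl⟩ := hc_compl.ge hb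
      exact ⟨.inl ⟨x, hx⟩, rfl⟩
  have hf_rel : ∀ a b, SurgeryRel h N B a b → f a = f b := by
    rintro _ _ ⟨x, u, w, hx⟩
    exact (congrArg c hx).trans (hΨB u w).symm
  have hglue : ∀ (x : N.Exterior h) (p : SolidTorus), f (.inl x) = f (.inr p) →
      (Quot.mk _ (.inl x) : Surgery h N B) = Quot.mk _ (.inr p) := by
    rintro x ⟨u, z⟩ hxp
    have hz : ‖(z : ℂ)‖ = 1 := by
      refine z.norm_le_one.antisymm (not_lt.1 fun hlt => hc_compl.le ⟨_, x.2, rfl⟩ ?_)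
      exact (congrArg (· ∈ N'.openCarrier h') hxp).mpr
        ((N'.toOpenBook_mem_openCarrier_iff h').2 ((hΨ _).trans_lt hlt))
    obtain ⟨w, rfl⟩ := Disc.exists_eq_ofCircle hz
    exact Quot.sound (.glue x u w (c.injective (hxp.trans (hΨB u w))))
  obtain ⟨Φ, hΦ⟩ := exists_homeomorph_quot
    (hf_closed.isQuotientMap hf_continuous hf_surjective) hf_rel fun a b hab => by
      rcases a with x | p <;> rcases b with y | p'
      · rw [Subtype.ext (c.injective hab)]
      · exact hglue x p' hab
      · exact (hglue y p hab.symm).symm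
      · rw [Ψ.injective (N'.injective_toOpenBook h' hab)]
  exact ⟨Φ, fun x => hΦ (.inl x), (Set.range_comp _ _).symm.trans <|
    (congrArg Set.range (funext fun p => hΦ (.inr p))).trans
      (Ψ.surjective.range_comp (N'.toOpenBook h'))⟩

/-! ### Spanning discs -/

namespace Disc

/-- The direction of a point of the plane, with the junk value `1` at the origin. -/
def direction (z : ℂ) : Circle := Circle.exp z.arg

theorem norm_mul_direction (z : ℂ) : (‖z‖ : ℂ) * direction z = z := by
  rw [direction, Circle.coe_exp, Complex.norm_mul_exp_arg_mul_I]

theorem continuousOn_direction : ContinuousOn direction {0}ᶜ := by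
  have hcoe : Topology.IsInducing fun u : Circle => (u : ℂ) := Topology.IsInducing.subtypeVal
  rw [hcoe.continuousOn_iff]
  have hdiv : ContinuousOn (fun z : ℂ => z / (‖z‖ : ℂ)) {0}ᶜ :=
    continuousOn_id.div (by fun_prop) fun z hz => by simpa using hz
  refine hdiv.congr fun z hz => ?_
  rw [eq_div_iff (by simpa using hz), mul_comm]
  exact norm_mul_direction z

theorem norm_ofReal_mul_circle {r : ℝ} (hr : 0 ≤ r) (u : Circle) : ‖(r : ℂ) * u‖ = r := by
  rw [norm_mul, Circle.norm_coe, mul_one, Complex.norm_of_nonneg hr]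

theorem direction_ofReal_mul_circle {r : ℝ} (hr : 0 < r) (u : Circle) :
    direction ((r : ℂ) * u) = u := by
  have h := norm_mul_direction ((r : ℂ) * u)
  rw [norm_ofReal_mul_circle hr.le] at h
  exact Circle.ext (mul_left_cancel₀ (Complex.ofReal_ne_zero.2 hr.ne') h)

/-- The radial retraction of the plane onto the disc. -/
def retract (z : ℂ) : Disc :=
  ⟨z / (max 1 ‖z‖ : ℝ), mem_closedBall_zero_iff.2 <| by
    rw [norm_div, Complex.norm_of_nonneg (zero_le_one.trans (le_max_left _ _))]
    exact div_le_one_of_le₀ (le_max_right _ _) (zero_le_one.trans (le_max_left _ _))⟩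

theorem coe_retract {z : ℂ} (hz : ‖z‖ ≤ 1) : (retract z : ℂ) = z := by
  simp only [retract, max_eq_left hz, Complex.ofReal_one, div_one]

theorem continuous_retract : Continuous retract := by
  refine Continuous.subtype_mk (continuous_id.div (by fun_prop) fun z => ?_) _
  exact Complex.ofReal_ne_zero.2 (zero_lt_one.trans_le (le_max_left _ _)).ne'

/-- The ratio of the radius of the new regular neighbourhood to that of the new solid torus. -/
def half : Set.Ioc (0 : ℝ) 1 := ⟨1 / 2, by norm_num⟩

theorem coe_scale_half (z : Disc) : (scale half z : ℂ) = z / 2 := by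
  rw [scale, half]
  push_cast
  ring

theorem retract_two_mul_scale_half (z : Disc) : retract (2 * scale half z) = z := by
  have hz : (2 : ℂ) * scale half z = z := by
    rw [coe_scale_half, mul_div_cancel₀ _ two_ne_zero]
  rw [hz]
  exact Subtype.ext (coe_retract z.norm_le_one)

theorem exists_eq_scale_half {z : Disc} (hz : ‖(z : ℂ)‖ < 1 / 4) :
    ∃ w, z = scale half w ∧ ‖(w : ℂ)‖ < 1 / 2 := by
  obtain ⟨w, rfl⟩ := exists_eq_scale (c := half) (hz.le.trans (by norm_num [half]))
  rw [norm_scale, half] at hz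
  exact ⟨w, rfl, by linarith⟩

end Disc

namespace SolidTorus

/-- The distance from the core, in the solid torus, of the points of the collar which are at the
distance `ρ` from the centre of the disc. The slope changes at `ρ = 1 / 2`, outside of which the
collar has the parametrization required for the solid torus of radius `1 / 2`. -/
def collarRadius (ρ : ℝ) : unitInterval :=
  Set.projIcc 0 1 zero_le_one (max (1 - ρ) (3 / 2 - 2 * ρ))

theorem coe_collarRadius {ρ : ℝ} (hρ : ρ ∈ Set.Icc (1 / 4) 1) :
    (collarRadius ρ : ℝ) = max (1 - ρ) (3 / 2 - 2 * ρ) := by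
  obtain ⟨hρ, hρ'⟩ := hρ
  rw [collarRadius, Set.projIcc_of_mem]
  exact ⟨le_max_of_le_left (by linarith), max_le (by linarith) (by linarith)⟩

theorem injOn_collarRadius : Set.InjOn collarRadius (Set.Icc (1 / 4) 1) := fun ρ hρ ρ' hρ' h => by
  have heq := congrArg ((↑) : unitInterval → ℝ) h
  rw [coe_collarRadius hρ, coe_collarRadius hρ'] at heq
  rcases max_cases (1 - ρ) (3 / 2 - 2 * ρ) with h2 | h2 <;>
    rcases max_cases (1 - ρ') (3 / 2 - 2 * ρ') with h3 | h3 <;> linarith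

variable (q : ℤ) (φ : C(Circle, ℝ))

/-- The direction of the collar in the meridian discs: as `‖z‖` increases from `1 / 4` to `1 / 2`,
the direction `e ^ {i φ(u)}` over `u = z / ‖z‖` is isotoped to `1`. -/
def collarDir (z : ℂ) : Circle :=
  Circle.exp (Set.projIcc (0 : ℝ) 1 zero_le_one (2 - 4 * ‖z‖) * φ (Disc.direction z))

/-- A collar in the solid torus, which ends in the image under `lowerTwist q` of the curve
`u ↦ (u, e ^ {i φ(u)})`. -/
def collar (z : ℂ) : SolidTorus :=
  (Disc.direction z * lowerPhase (collarDir φ z) ^ q,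
    Disc.polar (collarRadius ‖z‖) (collarDir φ z))

theorem collarDir_of_half_le {z : ℂ} (hz : 1 / 2 ≤ ‖z‖) : collarDir φ z = 1 := by
  rw [collarDir, Set.projIcc_of_le_left _ (by linarith), zero_mul, Circle.exp_zero]

theorem collarDir_of_le_quarter {z : ℂ} (hz : ‖z‖ ≤ 1 / 4) :
    collarDir φ z = Circle.exp (φ (Disc.direction z)) := by
  rw [collarDir, Set.projIcc_of_right_le _ (by linarith), one_mul]

theorem norm_collar (z : ℂ) : ‖((collar q φ z).2 : ℂ)‖ = collarRadius ‖z‖ :=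
  Disc.norm_polar _ _

theorem collar_of_half_le {z : ℂ} (hz : 1 / 2 ≤ ‖z‖) :
    collar q φ z = (Disc.direction z, Disc.polar (collarRadius ‖z‖) 1) := by
  rw [collar, collarDir_of_half_le φ hz, lowerPhase_of_nonneg (by simp), one_zpow, mul_one]

theorem collar_of_norm_eq_quarter {z : ℂ} (hz : ‖z‖ = 1 / 4) :
    collar q φ z =
      lowerTwist q (Disc.direction z, Disc.ofCircle (Circle.exp (φ (Disc.direction z)))) := by
  have hradius : collarRadius ‖z‖ = 1 := Subtype.ext <| by
    rw [hz, coe_collarRadius (by norm_num)]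
    norm_num
  rw [collar, hradius, collarDir_of_le_quarter φ hz.le, lowerTwist, shear_apply, Disc.coe_ofCircle,
    Disc.ofCircle]

theorem continuousOn_collarDir : ContinuousOn (collarDir φ) {0}ᶜ :=
  Circle.exp.continuous.comp_continuousOn <|
    (continuous_subtype_val.comp (continuous_projIcc.comp (by fun_prop))).continuousOn.mul
      (φ.continuous.comp_continuousOn Disc.continuousOn_direction)

theorem continuousOn_collar : ContinuousOn (collar q φ) {0}ᶜ := by
  refine (Disc.continuousOn_direction.mul ((continuous_lowerPhase.zpow q).comp_continuousOn
    (continuousOn_collarDir φ))).prodMk ?_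
  refine Disc.continuous_polar.comp_continuousOn (ContinuousOn.prodMk ?_ (continuousOn_collarDir φ))
  exact ((continuous_projIcc (h := zero_le_one' ℝ)).comp
    (by fun_prop : Continuous fun z : ℂ => max (1 - ‖z‖) (3 / 2 - 2 * ‖z‖))).continuousOn

theorem injOn_collar : Set.InjOn (collar q φ) {z | ‖z‖ ∈ Set.Icc (1 / 4) 1} := by
  intro z hz z' hz' heq
  have hnorm : ‖z‖ = ‖z'‖ := by
    refine injOn_collarRadius hz hz' (Subtype.ext ?_)
    rw [← norm_collar q φ, ← norm_collar q φ, heq]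
  have hdir : collarDir φ z = collarDir φ z' := by
    rcases le_or_gt (1 / 2) ‖z‖ with hlarge | hsmall
    · rw [collarDir_of_half_le φ hlarge, collarDir_of_half_le φ (hnorm ▸ hlarge)]
    · have hradius : (collarRadius ‖z‖ : ℝ) ≠ 0 := by
        rw [coe_collarRadius hz]
        exact (lt_max_of_lt_left (by linarith)).ne'
      have hsnd := congrArg (fun p : SolidTorus => (p.2 : ℂ)) heq
      simp only [collar, Disc.coe_polar, ← hnorm] at hsnd
      exact Circle.ext (mul_left_cancel₀ (Complex.ofReal_ne_zero.2 hradius) hsnd)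
  have hdirection : Disc.direction z = Disc.direction z' := by
    have hfst := congrArg Prod.fst heq
    simp only [collar, hdir] at hfst
    exact mul_right_cancel hfst
  rw [← Disc.norm_mul_direction z, ← Disc.norm_mul_direction z', hnorm, hdirection]

end SolidTorus

namespace SpanningDisc

variable {γ : Circle → S} {A : AnnularNbhd γ} {t₀ : unitInterval} {h : S ≃ₜ S}
  {N : RegularNbhd A t₀} (D : SpanningDisc h N)

theorem hasClass_longitudeCurve_of_hasTwisting_zero (htw : D.HasTwisting 0) :
    HasClass D.longitudeCurve (0, 1) := by
  obtain ⟨lamS, lamD, hS, hD, heq⟩ := htw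
  rw [zero_smul, add_zero] at heq
  rwa [← heq, hS.unique hasClass_pageCurve] at hD

theorem hasTwisting_zero_of_dir_eq_one (hdir : ∀ u, D.dir u = 1) : D.HasTwisting 0 := by
  have hcurve : D.longitudeCurve = pageCurve := funext fun u => Prod.ext rfl (hdir u)
  exact ⟨(0, 1), (0, 1), hasClass_pageCurve, hcurve ▸ hasClass_pageCurve, by
    rw [zero_smul, add_zero]⟩

theorem exists_toFun_eq {z : Disc} (hz : 1 / 2 ≤ ‖(z : ℂ)‖) :
    ∃ r : unitInterval, (r : ℝ) = 2 * (1 - ‖(z : ℂ)‖) ∧ D.toFun z = N.toOpenBook h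
      (Disc.direction z, Disc.polar r (D.dir (Disc.direction z))) := by
  have hz' := z.norm_le_one
  refine ⟨⟨2 * (1 - ‖(z : ℂ)‖), by linarith, by linarith⟩, rfl, D.collar z _ _ ?_⟩
  rw [mul_div_cancel_left₀ _ two_ne_zero, sub_sub_cancel, Disc.norm_mul_direction]

theorem mem_carrier_iff {z : Disc} : D.toFun z ∈ N.carrier h ↔ 1 / 2 ≤ ‖(z : ℂ)‖ := by
  refine ⟨fun hz => not_lt.1 fun hlt => D.notMem z hlt hz, fun hz => ?_⟩
  obtain ⟨r, -, hr⟩ := D.exists_toFun_eq hz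
  exact ⟨_, hr.symm⟩

theorem notMem_openCarrier {z : Disc} (hz : ‖(z : ℂ)‖ ≤ 1 / 2) :
    D.toFun z ∉ N.openCarrier h := by
  rcases hz.lt_or_eq with hlt | heq
  · exact fun hmem => D.notMem z hlt (Set.image_subset_range _ _ hmem)
  · obtain ⟨r, hr, hDr⟩ := D.exists_toFun_eq heq.ge
    rw [hDr, N.toOpenBook_mem_openCarrier_iff, Disc.norm_polar, hr, heq]
    norm_num

variable [T2Space S] (q : ℤ) (φ : C(Circle, ℝ))

/-- The part of `D` outside of the neighbourhood, moved by the regluing and completed by a new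
collar in the neighbourhood. -/
def twistFun (z : Disc) : OpenBook (A.dehnTwist ^ q * h) :=
  if ‖(z : ℂ)‖ < 1 / 4 then N.openBookTwist q h (D.toFun (Disc.retract (2 * z)))
  else (N.twist q).toOpenBook _ (SolidTorus.collar q φ z)

theorem twistFun_of_quarter_le {z : Disc} (hz : 1 / 4 ≤ ‖(z : ℂ)‖) :
    D.twistFun q φ z = (N.twist q).toOpenBook _ (SolidTorus.collar q φ z) :=
  if_neg hz.not_gt

variable {φ} in
theorem twistFun_of_le_quarter (hφ : ∀ u, D.dir u = Circle.exp (φ u)) {z : Disc}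
    (hz : ‖(z : ℂ)‖ ≤ 1 / 4) :
    D.twistFun q φ z = N.openBookTwist q h (D.toFun (Disc.retract (2 * z))) := by
  rcases hz.lt_or_eq with hlt | heq
  · exact if_pos hlt
  · have hcollar : (Disc.retract (2 * z) : ℂ) =
        ((1 - ((1 : unitInterval) : ℝ) / 2 : ℝ) : ℂ) * Disc.direction (z : ℂ) := by
      rw [Disc.coe_retract (by rw [norm_mul, heq]; norm_num)]
      nth_rw 1 [← Disc.norm_mul_direction z, heq]
      push_cast
      ring
    rw [D.twistFun_of_quarter_le q φ heq.ge, SolidTorus.collar_of_norm_eq_quarter q φ heq,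
      ← N.openBookTwist_toOpenBook, D.collar _ _ _ hcollar, hφ]
    rfl

variable {φ} in
theorem continuous_twistFun (hφ : ∀ u, D.dir u = Circle.exp (φ u)) :
    Continuous (D.twistFun q φ) := by
  have hinner : ContinuousOn (D.twistFun q φ) {z | ‖(z : ℂ)‖ ≤ 1 / 4} := by
    refine ContinuousOn.congr ?_ fun z hz => D.twistFun_of_le_quarter q hφ hz
    refine (N.continuousOn_openBookTwist q h).comp (D.continuous_toFun.comp
      (Disc.continuous_retract.comp (by fun_prop))).continuousOn fun z hz => ?_
    obtain ⟨w, rfl⟩ := Disc.exists_eq_scale (c := Disc.half) (hz.trans (by norm_num [Disc.half]))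
    rw [Disc.retract_two_mul_scale_half]
    rw [Set.mem_ofPred_eq, Disc.norm_scale, Disc.half] at hz
    exact D.notMem_openCarrier (by linarith)
  have houter : ContinuousOn (D.twistFun q φ) {z | 1 / 4 ≤ ‖(z : ℂ)‖} := by
    refine ContinuousOn.congr ?_ fun z hz => D.twistFun_of_quarter_le q φ hz
    refine ((N.twist q).continuous_toOpenBook _).comp_continuousOn
      ((SolidTorus.continuousOn_collar q φ).comp continuous_subtype_val.continuousOn ?_)
    exact fun z (hz : 1 / 4 ≤ ‖(z : ℂ)‖) => norm_pos_iff.1 (by linarith)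
  exact continuousOn_univ.1 ((hinner.union_of_isClosed houter
    (isClosed_le (by fun_prop) continuous_const)
    (isClosed_le continuous_const (by fun_prop))).mono fun z _ => le_total ‖(z : ℂ)‖ (1 / 4))

theorem twistFun_scale_half {z : Disc} (hz : ‖(z : ℂ)‖ < 1 / 2) :
    D.twistFun q φ (Disc.scale Disc.half z) = N.openBookTwist q h (D.toFun z) := by
  rw [twistFun, if_pos, Disc.retract_two_mul_scale_half]
  rw [Disc.norm_scale, Disc.half]
  linarith

theorem twistFun_mem_carrier_iff {z : Disc} :
    D.twistFun q φ z ∈ (N.twist q).carrier _ ↔ 1 / 4 ≤ ‖(z : ℂ)‖ := by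
  refine ⟨fun hz => not_lt.1 fun hlt => ?_, fun hz => ?_⟩
  · obtain ⟨w, rfl, hw⟩ := Disc.exists_eq_scale_half hlt
    rw [D.twistFun_scale_half q φ hw, N.openBookTwist_mem_carrier_iff, D.mem_carrier_iff] at hz
    exact hz.not_gt hw
  · rw [D.twistFun_of_quarter_le q φ hz]
    exact Set.mem_range_self _

theorem injective_twistFun : Function.Injective (D.twistFun q φ) := by
  intro z z' hzz'
  have hiff : 1 / 4 ≤ ‖(z : ℂ)‖ ↔ 1 / 4 ≤ ‖(z' : ℂ)‖ := by
    rw [← D.twistFun_mem_carrier_iff q φ, hzz', D.twistFun_mem_carrier_iff q φ]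
  by_cases hz : 1 / 4 ≤ ‖(z : ℂ)‖
  · have hz' := hiff.1 hz
    rw [D.twistFun_of_quarter_le q φ hz, D.twistFun_of_quarter_le q φ hz'] at hzz'
    exact Subtype.ext (SolidTorus.injOn_collar q φ ⟨hz, z.norm_le_one⟩ ⟨hz', z'.norm_le_one⟩
      ((N.twist q).injective_toOpenBook _ hzz'))
  · obtain ⟨w, rfl, hw⟩ := Disc.exists_eq_scale_half (not_le.1 hz)
    obtain ⟨w', rfl, hw'⟩ := Disc.exists_eq_scale_half (not_le.1 (hiff.not.1 hz))
    rw [D.twistFun_scale_half q φ hw, D.twistFun_scale_half q φ hw'] at hzz'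
    rw [D.injective_toFun ((N.openBookTwist q h).injective hzz')]

theorem twistFun_notMem_carrier_shrink {z : Disc} (hz : ‖(z : ℂ)‖ < 1 / 2) :
    D.twistFun q φ z ∉ ((N.twist q).shrink Disc.half).carrier _ := by
  rintro ⟨p, hp⟩
  have hp' : D.twistFun q φ z =
      (N.twist q).toOpenBook _ (Prod.map id (Disc.scale Disc.half) p) := hp.symm
  have hquarter : 1 / 4 ≤ ‖(z : ℂ)‖ :=
    (D.twistFun_mem_carrier_iff q φ).1 (hp' ▸ Set.mem_range_self _)
  rw [D.twistFun_of_quarter_le q φ hquarter] at hp'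
  have hnorm := congrArg (fun p : SolidTorus => ‖(p.2 : ℂ)‖)
    ((N.twist q).injective_toOpenBook _ hp')
  simp only [SolidTorus.norm_collar, Prod.map_snd, Disc.norm_scale, Disc.half,
    SolidTorus.coe_collarRadius ⟨hquarter, z.norm_le_one⟩] at hnorm
  have hradius := le_max_left (1 - ‖(z : ℂ)‖) (3 / 2 - 2 * ‖(z : ℂ)‖)
  have hp_norm := p.2.norm_le_one
  linarith

variable {φ} in
/-- The spanning disc `twistFun`, in standard position with respect to the concentric
neighbourhood of half the radius. -/
def twist (hφ : ∀ u, D.dir u = Circle.exp (φ u)) :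
    SpanningDisc (A.dehnTwist ^ q * h) ((N.twist q).shrink Disc.half) where
  toFun := D.twistFun q φ
  continuous_toFun := D.continuous_twistFun q hφ
  injective_toFun := D.injective_twistFun q φ
  dir _ := 1
  continuous_dir := continuous_const
  collar z u s hz := by
    have hs := s.2.2
    have hnorm : ‖(z : ℂ)‖ = 1 - (s : ℝ) / 2 := by
      rw [hz, Disc.norm_ofReal_mul_circle (by linarith)]
    have hdirection : Disc.direction z = u := by
      rw [hz, Disc.direction_ofReal_mul_circle (by linarith)]
    have hquarter : 1 / 4 ≤ ‖(z : ℂ)‖ := by linarith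
    rw [D.twistFun_of_quarter_le q φ hquarter,
      SolidTorus.collar_of_half_le q φ (by linarith), hdirection]
    refine congrArg (fun w => (N.twist q).toOpenBook _ (u, w)) (Subtype.ext ?_)
    rw [Disc.coe_scale_half, Disc.coe_polar, Disc.coe_polar,
      SolidTorus.coe_collarRadius ⟨hquarter, z.norm_le_one⟩, max_eq_left (by linarith), hnorm]
    push_cast
    ring
  notMem _ hz := D.twistFun_notMem_carrier_shrink q φ hz

theorem range_twistFun_diff_carrier :
    Set.range (D.twistFun q φ) \ (N.twist q).carrier _ =
      N.openBookTwist q h '' (Set.range D.toFun \ N.carrier h) := by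
  ext b
  constructor
  · rintro ⟨⟨z, rfl⟩, hz⟩
    rw [D.twistFun_mem_carrier_iff, not_le] at hz
    obtain ⟨w, rfl, hw⟩ := Disc.exists_eq_scale_half hz
    rw [D.twistFun_scale_half q φ hw]
    exact ⟨_, ⟨⟨w, rfl⟩, D.notMem w hw⟩, rfl⟩
  · rintro ⟨_, ⟨⟨z, rfl⟩, hz⟩, rfl⟩
    refine ⟨⟨_, D.twistFun_scale_half q φ (not_le.1 (D.mem_carrier_iff.not.1 hz))⟩, ?_⟩
    rwa [N.openBookTwist_mem_carrier_iff]

end SpanningDisc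

end Surface

end Stallings

end

open Stallings in
theorem mainTheorem12_general {S : Type*} [TopologicalSpace S] [T2Space S]
    [ChartedSpace (EuclideanHalfSpace 2) S] (h : S ≃ₜ S) {γ : Circle → S} (A : AnnularNbhd γ)
    (t₀ : unitInterval) (N : RegularNbhd A t₀) (D : SpanningDisc h N) (lamD : TorusH1)
    (hlamD : HasClass D.longitudeCurve lamD) (htw : D.HasTwisting 0)
    (q : ℤ) (B : Matrix (Fin 2) (Fin 2) ℤ)
    (hB : IsGluingOfSlope B ((-1 : ℤ) • meridian + q • lamD)) :
    ∃ Φ : Surgery h N B ≃ₜ OpenBook (A.dehnTwist ^ q * h),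
      (∀ (x : S) (t : unitInterval) (hx : OpenBook.mk h (x, t) ∉ N.openCarrier h),
        ∃ y : S, Φ (Surgery.ofExterior h N B ⟨_, hx⟩) =
          OpenBook.mk (A.dehnTwist ^ q * h) (y, t)) ∧
      (∀ (x : S) (hx : OpenBook.mk h (x, t₀) ∉ N.openCarrier h),
        Φ (Surgery.ofExterior h N B ⟨_, hx⟩) =
          OpenBook.mk (A.dehnTwist ^ q * h) (x, t₀)) ∧
      ∃ (A' : AnnularNbhd γ) (N' : RegularNbhd A' t₀)
        (D' : SpanningDisc (A.dehnTwist ^ q * h) N'),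
        A'.IsShrinkingOf A ∧
        N'.carrier (A.dehnTwist ^ q * h) ⊆ Φ '' Surgery.newTorus h N B ∧
        Set.range D'.toFun \ Φ '' Surgery.newTorus h N B =
          (fun x => Φ (Surgery.ofExterior h N B x)) ''
            {x | x.1 ∈ Set.range D.toFun \ N.carrier h} ∧
        D'.HasTwisting 0 := by
  have hclass := D.hasClass_longitudeCurve_of_hasTwisting_zero htw
  obtain ⟨φ, hφ⟩ := hclass.1.exists_lift
  have hslope : (-1 : ℤ) • meridian + q • lamD = (-1, q) := by
    simp [meridian, hlamD.unique hclass]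
  obtain ⟨Ψ, hΨ_norm, hΨ⟩ := SolidTorus.exists_homeomorph_extending_lowerTwist (hslope ▸ hB)
  obtain ⟨Φ, hΦ, hΦV⟩ := Surgery.exists_homeomorph_openBook N (N.twist q) B (N.openBookTwist q h)
    (N.continuousOn_openBookTwist q h) (N.continuousOn_openBookTwist_symm q h)
    (N.openBookTwist_image_openCarrier q h) Ψ hΨ_norm fun u w =>
      (congrArg ((N.twist q).toOpenBook _) (hΨ u w)).trans (N.openBookTwist_toOpenBook q h _).symm
  refine ⟨Φ, fun x t hx => ⟨(applyBelow (A.dehnTwist ^ q) t₀ (x, t)).1, hΦ _⟩, fun x hx => ?_,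
    A.shrink Disc.half, (N.twist q).shrink Disc.half, D.twist q hφ, A.shrink_isShrinkingOf _, ?_,
    ?_, SpanningDisc.hasTwisting_zero_of_dir_eq_one _ fun _ => rfl⟩
  · rw [hΦ, N.openBookTwist_mk, applyBelow_of_le _ (show t₀ ≤ (x, t₀).2 from le_rfl)]
  · exact hΦV ▸ (N.twist q).carrier_shrink_subset _ _
  · rw [hΦV, funext hΦ]
    refine (D.range_twistFun_diff_carrier q φ).trans ?_
    have hsub : Set.range D.toFun \ N.carrier h ⊆ Set.range (Subtype.val : N.Exterior h → _) :=
      fun b hb => ⟨⟨b, fun hb' => hb.2 (Set.image_subset_range _ _ hb')⟩, rfl⟩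
    exact (congrArg _ (Set.image_preimage_eq_of_subset hsub).symm).trans (Set.image_image _ _ _)

theorem mainTheorem12 {S : Type*} [TopologicalSpace S] [T2Space S] [CompactSpace S]
    [ChartedSpace (EuclideanHalfSpace 2) S]
    -- `S` is a compact oriented surface, each component of which has non-empty boundary
    (hS : ∀ x : S, (connectedComponent x ∩ (𝓡∂ 2).boundary S).Nonempty)
    (o : Stallings.SurfaceOrientation S)
    -- the monodromy
    (h : S ≃ₜ S) (hh : ∀ x ∈ (𝓡∂ 2).boundary S, h x = x)
    -- the curve `C`, its annular neighbourhood in the page and its neighbourhood in `M`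
    {γ : Circle → S} (A : Stallings.AnnularNbhd γ) (hA : A.IsPositive o)
    (t₀ : unitInterval) (N : Stallings.RegularNbhd A t₀)
    -- the disc `D`, with longitude `λ_D`
    (D : Stallings.SpanningDisc h N) (lamD : Stallings.TorusH1)
    (hlamD : Stallings.HasClass D.longitudeCurve lamD) (htw : D.HasTwisting 0)
    -- the surgery with slope `p μ + q λ_D`, where `p = -1`
    (q : ℤ) (B : Matrix (Fin 2) (Fin 2) ℤ)
    (hB : Stallings.IsGluingOfSlope B ((-1 : ℤ) • Stallings.meridian + q • lamD)) :
    ∃ Φ : Stallings.Surgery h N B ≃ₜ Stallings.OpenBook (A.dehnTwist ^ q * h),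
      -- outside the glued-in solid torus, pages correspond to pages
      (∀ (x : S) (t : unitInterval) (hx : Stallings.OpenBook.mk h (x, t) ∉ N.openCarrier h),
        ∃ y : S, Φ (Stallings.Surgery.ofExterior h N B ⟨_, hx⟩) =
          Stallings.OpenBook.mk (A.dehnTwist ^ q * h) (y, t)) ∧
      -- and the page which contains `C` corresponds to itself by the identity
      (∀ (x : S) (hx : Stallings.OpenBook.mk h (x, t₀) ∉ N.openCarrier h),
        Φ (Stallings.Surgery.ofExterior h N B ⟨_, hx⟩) =
          Stallings.OpenBook.mk (A.dehnTwist ^ q * h) (x, t₀)) ∧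
      -- `C` bounds an embedded disc in the new open book, it has a regular neighbourhood in the
      -- glued-in solid torus, outside of which the new disc is `D`, and its twisting is zero
      ∃ (A' : Stallings.AnnularNbhd γ) (N' : Stallings.RegularNbhd A' t₀)
        (D' : Stallings.SpanningDisc (A.dehnTwist ^ q * h) N'),
        A'.IsShrinkingOf A ∧
        N'.carrier (A.dehnTwist ^ q * h) ⊆ Φ '' Stallings.Surgery.newTorus h N B ∧
        Set.range D'.toFun \ Φ '' Stallings.Surgery.newTorus h N B =
          (fun x => Φ (Stallings.Surgery.ofExterior h N B x)) ''
            {x | x.1 ∈ Set.range D.toFun \ N.carrier h} ∧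
        D'.HasTwisting 0 :=
  mainTheorem12_general h A t₀ N D lamD hlamD htw q B hB
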